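/- Let $k$ be a field, let $l\ge 1$ and $n\ge 2$ be integers, and let $Q$ be a basic cycle of length $l$, i.e. a quiver with $l$ distinct vertices $v_0,\dots,v_{l-1}$ and exactly $l$ arrows $a_i\colon v_i\to v_{i+1}$ (indices modulo $l$). Let $A=kQ/k^nQ$, where $kQ$ is the path algebra and $k^nQ$ is its two-sided ideal generated by all paths of length at least $n$. Let $HH_p(A)$ be the $p$-th Hochschild homology group of the $k$-algebra $A$, that is, the $p$-th homology of the complex $(A^{\otimes_k(p+1)},b_p)_{p\ge0}$ with $$b_p(a_0\otimes\cdots\otimes a_p)=\sum_{i=0}^{p-1}(-1)^i a_0\otimes\cdots\otimes a_ia_{i+1}\otimes\cdots\otimes a_p+(-1)^p a_pa_0\otimes a_1\otimes\cdots\otimes a_{p-1}.$$ Then every $HH_p(A)$ is finite-dimensional over $k$, and $hh_p(A):=\dim_k HH_p(A)$ is given as follows. Write $[x]$ for the largest integer $\le x$ and $(n,l)$ for $\gcd(n,l)$, and put $$N_p=\left[\frac{[\frac p2]n+n-1}{l}\right]-\left[\frac{[\frac p2]n}{l}\right].$$ Then $$hh_p(A)=\begin{cases} l+\left[\frac{n-1}{l}\right],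 & p=0;\\ N_p, & p\ge1,\ l\nmid[\frac{p+1}2]n;\\ N_p+(n,l)-1, & p\ge1,\ l\mid[\frac{p+1}2]n,\ \operatorname{char}k\nmid\frac{n}{(n,l)};\\ N_p+(n,l), & p\ge1,\ l\mid[\frac{p+1}2]n,\ \operatorname{char}k\mid\frac{n}{(n,l)}.\end{cases}$$ (If $\operatorname{char}k=0$, the last case does not occur, since $0$ does not divide the positive integer $n/(n,l)$.) -/

import Mathlib

/-! ## Path algebras and truncated quiver algebras -/

/-- A path of the quiver `V` together with its starting point and its ending point. -/
abbrev QuiverPath (V : Type*) [Quiver V] := Σ a b : V, Quiver.Path a b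

/-- The path algebra `kQ` as a vector space: the space with the set of all paths
(including the trivial path at each vertex) as a basis. -/
def PathAlgebra (k V : Type*) [Field k] [Quiver V] := QuiverPath V →₀ k

namespace PathAlgebra

noncomputable section

variable (k : Type*) {V : Type*} [Field k] [Quiver V]

instance : AddCommGroup (PathAlgebra k V) := inferInstanceAs (AddCommGroup (QuiverPath V →₀ k))

instance : Module k (PathAlgebra k V) := inferInstanceAs (Module k (QuiverPath V →₀ k))

/-- The basis vector given by a path. -/
def ofPath (p : QuiverPath V) : PathAlgebra k V := Finsupp.single p 1

variable {k}

theorem lhom_ext {M : Type*} [AddCommGroup M] [Module k M] {f g : PathAlgebra k V →ₗ[k] M}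
    (h : ∀ p, f (ofPath k p) = g (ofPath k p)) : f = g :=
  Finsupp.lhom_ext' fun p => LinearMap.ext_ring (h p)

variable (k)

open Classical in
/-- The product of two paths: `p` followed by `q` if `p` ends where `q` starts, and `0` otherwise. -/
def mulPath (p q : QuiverPath V) : PathAlgebra k V :=
  if h : p.2.1 = q.1 then ofPath k ⟨p.1, q.2.1, p.2.2.comp (q.2.2.cast h.symm rfl)⟩ else 0

/-- The multiplication of the path algebra, the bilinear extension of `mulPath`. -/
def mulLin : PathAlgebra k V →ₗ[k] PathAlgebra k V →ₗ[k] PathAlgebra k V :=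
  Finsupp.linearCombination k fun p => Finsupp.linearCombination k fun q => mulPath k p q

instance : Mul (PathAlgebra k V) := ⟨fun x y => mulLin k x y⟩

theorem mul_def (x y : PathAlgebra k V) : x * y = mulLin k x y := rfl

theorem mulLin_ofPath (p q : QuiverPath V) :
    mulLin k (ofPath k p) (ofPath k q) = mulPath k p q := by
  unfold mulLin
  erw [Finsupp.linearCombination_single, one_smul, Finsupp.linearCombination_single, one_smul]

theorem mulLin_assoc_path (p q r : QuiverPath V) :
    mulLin k (mulPath k p q) (ofPath k r) = mulLin k (ofPath k p) (mulPath k q r) := by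
  obtain ⟨a, b, p⟩ := p
  obtain ⟨c, d, q⟩ := q
  obtain ⟨e, f, r⟩ := r
  by_cases h1 : b = c
  · subst h1
    by_cases h2 : d = e
    · subst h2
      simp [mulPath, mulLin_ofPath]
    · simp [mulPath, mulLin_ofPath, h2]
  · by_cases h2 : d = e
    · subst h2
      simp [mulPath, mulLin_ofPath, h1]
    · simp [mulPath, h1, h2]

theorem induction {P : PathAlgebra k V → Prop} (x : PathAlgebra k V) (h0 : P 0)
    (hadd : ∀ x y, P x → P y → P (x + y)) (hsmul : ∀ (c : k) p, P (c • ofPath k p)) : P x := by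
  refine Finsupp.induction_linear x h0 (fun f g hf hg => hadd f g hf hg) fun p c => ?_
  have h := hsmul c p
  unfold ofPath at h
  erw [Finsupp.smul_single, smul_eq_mul, mul_one] at h
  exact h

theorem mulLin_assoc (x y z : PathAlgebra k V) :
    mulLin k (mulLin k x y) z = mulLin k x (mulLin k y z) := by
  induction x using PathAlgebra.induction with
  | h0 => simp
  | hadd x x' hx hx' => simp [hx, hx']
  | hsmul c p =>
    induction y using PathAlgebra.induction with
    | h0 => simp
    | hadd y y' hy hy' => simp only [map_add, LinearMap.add_apply, hy, hy']
    | hsmul d q =>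
      induction z using PathAlgebra.induction with
      | h0 => simp
      | hadd z z' hz hz' => simp only [map_add, hz, hz']
      | hsmul e r =>
        simp only [map_smul, LinearMap.smul_apply, mulLin_ofPath, mulLin_assoc_path]

variable [Fintype V]

/-- The identity of the path algebra, the sum of the trivial paths at all vertices. -/
instance : One (PathAlgebra k V) := ⟨∑ v : V, ofPath k ⟨v, v, Quiver.Path.nil⟩⟩

theorem one_def : (1 : PathAlgebra k V) = ∑ v : V, ofPath k ⟨v, v, Quiver.Path.nil⟩ := rfl

theorem mulLin_one_left (x : PathAlgebra k V) : mulLin k 1 x = x := by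
  induction x using PathAlgebra.induction with
  | h0 => simp
  | hadd x x' hx hx' => simp [hx, hx']
  | hsmul c p =>
    obtain ⟨a, b, p⟩ := p
    rw [map_smul, one_def, map_sum, LinearMap.sum_apply, Finset.sum_eq_single a]
    · simp [mulLin_ofPath, mulPath]
    · intro v _ hv
      simp [mulLin_ofPath, mulPath, hv]
    · simp

theorem mulLin_one_right (x : PathAlgebra k V) : mulLin k x 1 = x := by
  induction x using PathAlgebra.induction with
  | h0 => simp
  | hadd x x' hx hx' => simp [hx, hx']
  | hsmul c p =>
    obtain ⟨a, b, p⟩ := p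
    rw [map_smul, LinearMap.smul_apply, one_def, map_sum, Finset.sum_eq_single b]
    · simp [mulLin_ofPath, mulPath]
    · intro v _ hv
      simp [mulLin_ofPath, mulPath, hv.symm]
    · simp

instance : Ring (PathAlgebra k V) :=
  { (inferInstance : AddCommGroup (PathAlgebra k V)),
    (inferInstance : Mul (PathAlgebra k V)),
    (inferInstance : One (PathAlgebra k V)) with
    left_distrib := fun x y z => by simp only [mul_def, map_add]
    right_distrib := fun x y z => by simp only [mul_def, map_add, LinearMap.add_apply]
    zero_mul := fun x => by simp only [mul_def, map_zero, LinearMap.zero_apply]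
    mul_zero := fun x => by simp only [mul_def, map_zero]
    mul_assoc := fun x y z => by simp only [mul_def, mulLin_assoc]
    one_mul := fun x => by simp only [mul_def, mulLin_one_left]
    mul_one := fun x => by simp only [mul_def, mulLin_one_right] }

instance : Algebra k (PathAlgebra k V) :=
  Algebra.ofModule (fun c x y => by simp only [mul_def, map_smul, LinearMap.smul_apply])
    (fun c x y => by simp only [mul_def, map_smul])

variable (V)

/-- The two-sided ideal `kⁿQ` of `kQ` generated by all paths of length at least `n`. -/
def truncationIdeal (n : ℕ) : TwoSidedIdeal (PathAlgebra k V) :=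
  TwoSidedIdeal.span {x | ∃ p : QuiverPath V, n ≤ p.2.2.length ∧ x = ofPath k p}

end

end PathAlgebra

/-- The algebra `kQ/kⁿQ` (for `n ≥ 2`, a truncated quiver algebra). -/
abbrev TruncatedQuiverAlgebra (k V : Type*) [Field k] [Quiver V] [Fintype V] (n : ℕ) :=
  (PathAlgebra.truncationIdeal k V n).ringCon.Quotient

/-- The quiver `V` is a basic cycle of length `l`: its arrows form one cycle `a₀ a₁ ⋯ a_{l-1}`
whose starting points `v₀, …, v_{l-1}` are pairwise distinct and are all the vertices.
Indices are taken modulo `l`, so `aᵢ` goes from `vᵢ` to `vᵢ₊₁` and `a_{l-1}` goes back to `v₀`.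
The arrows `aᵢ` exhaust the arrows of `V`. -/
def IsBasicCycle (V : Type*) [Quiver V] (l : ℕ) : Prop :=
  1 ≤ l ∧ ∃ (v : ZMod l → V) (a : ∀ i, v i ⟶ v (i + 1)),
    Function.Bijective v ∧
      ∀ (x y : V) (f : x ⟶ y), ∃ i, (⟨x, y, f⟩ : Σ x y : V, x ⟶ y) = ⟨v i, v (i + 1), a i⟩

/-! ## Hochschild homology -/

namespace Hochschild

open scoped TensorProduct

noncomputable section

variable (k A : Type*) [Field k] [Ring A] [Algebra k A]

/-- The tuples occurring in the Hochschild boundary of `a₀ ⊗ ⋯ ⊗ aₙ₊₁`: for `i ≤ n` the `i`-th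
one is `(a₀, …, aᵢ aᵢ₊₁, …, aₙ₊₁)`, and for `i = n + 1` it is `(aₙ₊₁ a₀, a₁, …, aₙ)`. -/
def faceFun {A : Type*} [Mul A] {n : ℕ} (i : Fin (n + 2)) (a : Fin (n + 2) → A) : Fin (n + 1) → A :=
  fun j =>
    if i = Fin.last (n + 1) then
      if j = 0 then a (Fin.last (n + 1)) * a 0 else a j.castSucc
    else
      if j.val < i.val then a j.castSucc
      else if j.val = i.val then a j.castSucc * a j.succ else a j.succ

theorem faceFun_val {A : Type*} [Mul A] {n : ℕ} (i : Fin (n + 2)) (b : ℕ → A) :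
    faceFun i (fun x => b x.val) = fun j : Fin (n + 1) =>
      if i.val = n + 1 then if j.val = 0 then b (n + 1) * b 0 else b j.val
      else if j.val < i.val then b j.val
        else if j.val = i.val then b j.val * b (j.val + 1) else b (j.val + 1) := by
  funext j
  simp only [faceFun, Fin.ext_iff, Fin.val_last, Fin.val_zero, Fin.val_castSucc, Fin.val_succ]

theorem exists_eq_val {A : Type*} {n : ℕ} (a : Fin (n + 1) → A) :
    ∃ b : ℕ → A, a = fun x => b x.val :=
  ⟨fun t => if h : t < n + 1 then a ⟨t, h⟩ else a 0, by funext x; simp [x.isLt]⟩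

variable {A} in
theorem faceFun_update {n : ℕ} (i : Fin (n + 2)) (a : Fin (n + 2) → A) (m : Fin (n + 2)) :
    ∃ (g : Fin (n + 1)) (L : A →ₗ[k] A),
      ∀ x, faceFun i (Function.update a m x) = Function.update (faceFun i a) g (L x) := by
  obtain ⟨b, rfl⟩ := exists_eq_val a
  have hup : ∀ x, Function.update (fun x : Fin (n + 2) => b x.val) m x =
      fun y => (Function.update b m.val x) y.val := by
    intro x
    funext y
    by_cases h : y = m <;> simp [Function.update_apply, Fin.ext_iff]
  suffices h : ∃ (g : ℕ) (_ : g < n + 1) (L : A →ₗ[k] A), ∀ x, ∀ j < n + 1,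
      (if i.val = n + 1 then
        if j = 0 then Function.update b m.val x (n + 1) * Function.update b m.val x 0
        else Function.update b m.val x j
      else if j < i.val then Function.update b m.val x j
        else if j = i.val then Function.update b m.val x j * Function.update b m.val x (j + 1)
        else Function.update b m.val x (j + 1)) =
      if j = g then L x else
        if i.val = n + 1 then if j = 0 then b (n + 1) * b 0 else b j
        else if j < i.val then b j
          else if j = i.val then b j * b (j + 1) else b (j + 1) by
    obtain ⟨g, hg, L, hL⟩ := h
    refine ⟨⟨g, hg⟩, L, fun x => funext fun j => ?_⟩
    rw [hup, faceFun_val, faceFun_val, Function.update_apply (β := A) _ (⟨g, hg⟩ : Fin (n + 1))]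
    simp only [Fin.ext_iff]
    exact hL x j.val j.isLt
  obtain ⟨m, hm⟩ := m
  obtain ⟨i, hi⟩ := i
  simp only [Function.update_apply]
  by_cases hi' : i = n + 1
  · by_cases hm' : m = n + 1
    · exact ⟨0, by omega, LinearMap.mulRight k (b 0), by simp only [LinearMap.mulRight_apply]; grind⟩
    · by_cases hm0 : m = 0
      · exact ⟨0, by omega, LinearMap.mulLeft k (b (n + 1)),
          by simp only [LinearMap.mulLeft_apply]; grind⟩
      · exact ⟨m, by omega, LinearMap.id, by simp only [LinearMap.id_apply]; grind⟩
  · rcases lt_trichotomy m i with h | h | h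
    · exact ⟨m, by omega, LinearMap.id, by simp only [LinearMap.id_apply]; grind⟩
    · exact ⟨m, by omega, LinearMap.mulRight k (b (m + 1)),
        by simp only [LinearMap.mulRight_apply]; grind⟩
    · by_cases h' : m = i + 1
      · exact ⟨i, by omega, LinearMap.mulLeft k (b i),
          by simp only [LinearMap.mulLeft_apply]; grind⟩
      · exact ⟨m - 1, by omega, LinearMap.id, by simp only [LinearMap.id_apply]; grind⟩

theorem faceFun_faceFun {A : Type*} [Semigroup A] {n : ℕ} (i : Fin (n + 2)) (j : Fin (n + 3))
    (h : j.val ≤ i.val) (a : Fin (n + 3) → A) :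
    faceFun i (faceFun j a) = faceFun (j.castLT (h.trans_lt i.isLt)) (faceFun i.succ a) := by
  obtain ⟨b, rfl⟩ := exists_eq_val a
  rw [faceFun_val, faceFun_val]
  obtain ⟨i, hi⟩ := i
  obtain ⟨j, hj⟩ := j
  funext ⟨m, hm⟩
  simp only [faceFun, Fin.ext_iff, Fin.val_last, Fin.val_castLT, Fin.val_zero,
    Fin.castSucc_mk, Fin.succ_mk] at h ⊢
  grind [mul_assoc]

/-- The `i`-th face map `A^{⊗(n+2)} → A^{⊗(n+1)}`. -/
def face (n : ℕ) (i : Fin (n + 2)) :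
    (⨂[k] _ : Fin (n + 2), A) →ₗ[k] (⨂[k] _ : Fin (n + 1), A) :=
  PiTensorProduct.lift
    (MultilinearMap.mk' (fun a : Fin (n + 2) → A => PiTensorProduct.tprod k (faceFun i a))
      (fun a m x y => by
        obtain ⟨g, L, h⟩ := faceFun_update k i a m
        simp only [h, map_add, MultilinearMap.map_update_add])
      (fun a m c x => by
        obtain ⟨g, L, h⟩ := faceFun_update k i a m
        simp only [h, map_smul, MultilinearMap.map_update_smul]))

@[simp]
theorem face_tprod (n : ℕ) (i : Fin (n + 2)) (a : Fin (n + 2) → A) :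
    face k A n i (PiTensorProduct.tprod k a) = PiTensorProduct.tprod k (faceFun i a) := by
  simp [face]

/-- The Hochschild boundary `A^{⊗(n+2)} → A^{⊗(n+1)}`,
`(a₀, …, aₙ₊₁) ↦ ∑ i ≤ n, (-1)ⁱ (a₀, …, aᵢ aᵢ₊₁, …, aₙ₊₁) + (-1)ⁿ⁺¹ (aₙ₊₁ a₀, a₁, …, aₙ)`. -/
def boundary (n : ℕ) : (⨂[k] _ : Fin (n + 2), A) →ₗ[k] (⨂[k] _ : Fin (n + 1), A) :=
  ∑ i : Fin (n + 2), (-1 : k) ^ i.val • face k A n i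

theorem face_comp_face {n : ℕ} (i : Fin (n + 2)) (j : Fin (n + 3)) (h : j.val ≤ i.val) :
    face k A n i ∘ₗ face k A (n + 1) j =
      face k A n (j.castLT (h.trans_lt i.isLt)) ∘ₗ face k A (n + 1) i.succ := by
  refine PiTensorProduct.ext (MultilinearMap.ext fun a => ?_)
  simp [faceFun_faceFun i j h a]

theorem boundary_comp_boundary (n : ℕ) : boundary k A n ∘ₗ boundary k A (n + 1) = 0 := by
  refine LinearMap.ext fun t => ?_
  simp only [boundary, LinearMap.comp_apply, LinearMap.sum_apply, LinearMap.smul_apply, map_sum,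
    map_smul, LinearMap.zero_apply, Finset.smul_sum]
  rw [Finset.sum_comm]
  simp only [← Finset.sum_product']
  let P := Fin (n + 2) × Fin (n + 3)
  let S : Finset P := {ij : P | (ij.2 : ℕ) ≤ (ij.1 : ℕ)}
  rw [Finset.univ_product_univ, ← Finset.sum_add_sum_compl S, ← eq_neg_iff_add_eq_zero,
    ← Finset.sum_neg_distrib]
  let φ : ∀ ij : P, ij ∈ S → P := fun ij hij =>
    (Fin.castLT ij.2 (lt_of_le_of_lt (Finset.mem_filter.mp hij).right (Fin.is_lt ij.1)), ij.1.succ)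
  apply Finset.sum_bij φ
  · intro ij hij
    simp_rw [S, φ, Finset.compl_filter, Finset.mem_filter_univ, Fin.val_succ,
      Fin.val_castLT] at hij ⊢
    lia
  · rintro ⟨i, j⟩ hij ⟨i', j'⟩ hij' h
    rw [Prod.mk_inj]
    have h1 := congr_arg (fun x => x.1.val) h
    have h2 := congr_arg (fun x => x.2.val) h
    simp only [φ, Fin.val_castLT, Fin.val_succ] at h1 h2
    exact ⟨Fin.ext (by omega), Fin.ext (by omega)⟩
  · rintro ⟨i', j'⟩ hij'
    simp_rw [S, Finset.compl_filter, Finset.mem_filter_univ, not_le] at hij'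
    refine ⟨(j'.pred <| ?_, Fin.castSucc i'), ?_, ?_⟩
    · rintro rfl
      simp only [Fin.val_zero, not_lt_zero] at hij'
    · simpa [S] using! Nat.le_sub_one_of_lt hij'
    · simp only [φ, Fin.castLT_castSucc, Fin.succ_pred]
  · rintro ⟨i, j⟩ hij
    have hij' : j.val ≤ i.val := by simpa [S] using hij
    simp only [φ]
    have hf := LinearMap.congr_fun (face_comp_face k A i j hij') t
    simp only [LinearMap.comp_apply] at hf
    rw [hf, smul_smul, smul_smul, ← neg_smul]
    congr 1
    simp only [Fin.val_succ, Fin.val_castLT, pow_succ]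
    ring

/-- The Hochschild complex `⋯ → A^{⊗(n+1)} → ⋯ → A ⊗ A → A → 0` of the `k`-algebra `A`;
its degree `n` term is the `(n+1)`-fold tensor power of `A` over `k`. -/
def complex : ChainComplex (ModuleCat k) ℕ :=
  ChainComplex.of (fun n => ModuleCat.of k (⨂[k] _ : Fin (n + 1), A))
    (fun n => ModuleCat.ofHom (boundary k A n))
    (fun n => by
      rw [← ModuleCat.ofHom_comp, boundary_comp_boundary]
      rfl)

end

end Hochschild

/-- The `p`-th Hochschild homology group `HH_p(A)` of the `k`-algebra `A`. -/
noncomputable abbrev HH (k A : Type*) [Field k] [Ring A] [Algebra k A] (p : ℕ) : ModuleCat k :=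
  (Hochschild.complex k A).homology p

/-- `hh_p(A)`, the dimension of `HH_p(A)` over `k` (meaningful if `HH_p(A)` is
finite-dimensional). -/
noncomputable def hh (k A : Type*) [Field k] [Ring A] [Algebra k A] (p : ℕ) : ℕ :=
  Module.finrank k (HH k A p)

/-! Hochschild homology is `Tor` over the enveloping algebra `Aᵉ = A ⊗ Aᵐᵒᵖ`: the Hochschild complex
is the commutator quotient `M ↦ M / [A, M]` of the bar resolution. This functor is additive and
projective resolutions are unique up to homotopy, so the bar resolution may be replaced by a much
smaller one (`Hochschild.nonempty_HH_iso`).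

Let `x` be the sum of the arrows and `e i` the vertex idempotents. The elements `e i * x ^ a` with
`a < n` form a basis of `A`, and `x ^ n = 0`. Put `z₁ = x ⊗ 1`, `z₂ = 1 ⊗ x` and `eps m = ∑ e i ⊗ e
(i + m)`. The small resolution consists of the projective left ideals `Aᵉ * eps m`, where `m` is `c
n` in degree `2c` and `c n + 1` in degree `2c + 1`. Its differentials are right multiplications,
alternately by `z₁ - z₂` and by `geom n = ∑ z₁ ^ t z₂ ^ (n - 1 - t)`. Consecutive differentials
compose to `z₁ ^ n - z₂ ^ n = 0`. Exactness comes from explicit linear contractions, checked on the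
spanning elements `(e i ⊗ w) z₁ ^ a` (`contr₀_mul`, `contr₀_add_contr₁`, `contr₁_mul_geom`).

The commutator quotient of `Aᵉ * eps m` is the span of the `e i * x ^ a` with `l ∣ a + m`. The
induced differentials are `y ↦ y x - x y` and `y ↦ ∑ x ^ (n - 1 - t) y x ^ t`. Both respect path
length, so their kernels are read off separately for each `a`. For the first, the coefficients must
be constant in `i` when `a < n - 1` and are free when `a = n - 1`. For the second, only `a = 0` is
constrained: all sums over `n` consecutive vertices must vanish. Such functions are periodic modulo
`g = gcd n l`, and the condition becomes `(n / g) ∑ h = 0` on `ZMod g`; this is where the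
characteristic enters (`finrank_normKer_of_dvd`, `finrank_normKer_of_not_dvd`).

In the dimension count the contributions of size `l` cancel. What remains in positive degree is the
number of multiples of `l` in an interval of length `n - 1`, which is `N_p`, together with the
dimension of that last kernel when the divisibility holds. -/

open CategoryTheory TensorProduct MulOpposite

namespace Hochschild

noncomputable section

universe u w

/-! ### Commutator quotients and independence of the projective resolution -/

section Comparison

variable (k : Type u) (A : Type w) [Field k] [Ring A] [Algebra k A]

/-- Restriction of scalars from bimodules to vector spaces. -/
abbrev toVect : ModuleCat.{w} (A ⊗[k] Aᵐᵒᵖ) ⥤ ModuleCat.{w} k :=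
  ModuleCat.restrictScalars (algebraMap k (A ⊗[k] Aᵐᵒᵖ))

/-- The subspace of commutators `a m - m a` of an `A`-bimodule. -/
def commutators (M : ModuleCat.{w} (A ⊗[k] Aᵐᵒᵖ)) : Submodule k ((toVect k A).obj M) :=
  Submodule.span k {y | ∃ (a : A) (m : M), y =
    (a ⊗ₜ[k] (1 : Aᵐᵒᵖ) : A ⊗[k] Aᵐᵒᵖ) • m - ((1 : A) ⊗ₜ[k] op a : A ⊗[k] Aᵐᵒᵖ) • m}

/-- The commutator quotient `M / [A, M]` of `A`-bimodules as a functor. -/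
def coinv : ModuleCat.{w} (A ⊗[k] Aᵐᵒᵖ) ⥤ ModuleCat.{w} k where
  obj M := ModuleCat.of k ((toVect k A).obj M ⧸ commutators k A M)
  map {M N} f := ModuleCat.ofHom (Submodule.mapQ (commutators k A M) (commutators k A N)
    ((toVect k A).map f).hom (Submodule.span_le.2 (by
      rintro _ ⟨a, m, rfl⟩
      exact Submodule.subset_span ⟨a, f.hom m, by
        change f.hom _ = _
        rw [map_sub, map_smul, map_smul]⟩)))
  map_id M := by
    ext x
    rfl
  map_comp f g := by
    ext x
    rfl

instance : (coinv k A).Additive where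
  map_add {M N f g} := by
    refine ModuleCat.hom_ext (LinearMap.ext fun x => ?_)
    obtain ⟨x, rfl⟩ := Submodule.Quotient.mk_surjective _ x
    rfl

/-- A presentation of the commutator quotient of the bimodule `X` as the vector space `Y`. -/
structure CommutatorQuotient (X : Type w) [AddCommGroup X] [Module (A ⊗[k] Aᵐᵒᵖ) X]
    (Y : Type w) [AddCommGroup Y] [Module k Y] where
  /-- The quotient map. -/
  proj : X →+ Y
  proj_smul : ∀ (c : k) x, proj (algebraMap k (A ⊗[k] Aᵐᵒᵖ) c • x) = c • proj x
  proj_comm : ∀ (a : A) x, proj ((a ⊗ₜ[k] (1 : Aᵐᵒᵖ) : A ⊗[k] Aᵐᵒᵖ) • x) =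
    proj (((1 : A) ⊗ₜ[k] op a : A ⊗[k] Aᵐᵒᵖ) • x)
  /-- A section of the quotient map. -/
  sec : Y →+ X
  proj_sec : ∀ y, proj (sec y) = y
  sub_mem : ∀ x, x - sec (proj x) ∈ AddSubgroup.closure {y | ∃ (a : A) (m : X), y =
    (a ⊗ₜ[k] (1 : Aᵐᵒᵖ) : A ⊗[k] Aᵐᵒᵖ) • m - ((1 : A) ⊗ₜ[k] op a : A ⊗[k] Aᵐᵒᵖ) • m}

namespace CommutatorQuotient

variable {k A}
variable {X : Type w} [AddCommGroup X] [Module (A ⊗[k] Aᵐᵒᵖ) X]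
    {Y : Type w} [AddCommGroup Y] [Module k Y]

/-- The quotient map as a `k`-linear map. -/
def lin (q : CommutatorQuotient k A X Y) : (toVect k A).obj (ModuleCat.of _ X) →ₗ[k] Y :=
  { q.proj with
    map_smul' := fun c x => q.proj_smul c x }

/-- `proj_comm` kills the commutators; conversely, when `proj x = 0`, `sub_mem` exhibits `x` itself
as a sum of commutators. -/
theorem ker_lin (q : CommutatorQuotient k A X Y) :
    LinearMap.ker q.lin = commutators k A (ModuleCat.of _ X) := by
  apply le_antisymm
  · intro x hx
    have key : ∀ x : X, q.proj x = 0 → x ∈ AddSubgroup.closure {y | ∃ (a : A) (m : X), y =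
        (a ⊗ₜ[k] (1 : Aᵐᵒᵖ) : A ⊗[k] Aᵐᵒᵖ) • m - ((1 : A) ⊗ₜ[k] op a : A ⊗[k] Aᵐᵒᵖ) • m} :=
      fun x hx => by simpa [hx] using q.sub_mem x
    have h2 : AddSubgroup.closure {y : (toVect k A).obj (ModuleCat.of _ X) |
        ∃ (a : A) (m : X), y =
        (a ⊗ₜ[k] (1 : Aᵐᵒᵖ) : A ⊗[k] Aᵐᵒᵖ) • m - ((1 : A) ⊗ₜ[k] op a : A ⊗[k] Aᵐᵒᵖ) • m} ≤
        (commutators k A (ModuleCat.of _ X)).toAddSubgroup :=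
      (AddSubgroup.closure_le _).2 fun y hy => Submodule.subset_span hy
    exact h2 (key x hx)
  · refine Submodule.span_le.2 ?_
    rintro _ ⟨a, m, rfl⟩
    change q.proj _ = 0
    rw [map_sub, sub_eq_zero]
    exact q.proj_comm a m

/-- The isomorphism of the commutator quotient with its presentation. -/
def iso (q : CommutatorQuotient k A X Y) :
    (coinv k A).obj (ModuleCat.of _ X) ≅ ModuleCat.of k Y :=
  LinearEquiv.toModuleIso ((Submodule.quotEquivOfEq _ _ q.ker_lin.symm).trans
    (q.lin.quotKerEquivOfSurjective fun y => ⟨q.sec y, q.proj_sec y⟩))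

theorem map_comp_iso {X' Y' : Type w} [AddCommGroup X'] [Module (A ⊗[k] Aᵐᵒᵖ) X']
    [AddCommGroup Y'] [Module k Y'] (q : CommutatorQuotient k A X Y)
    (q' : CommutatorQuotient k A X' Y') (f : X →ₗ[A ⊗[k] Aᵐᵒᵖ] X') (g : Y →ₗ[k] Y')
    (h : ∀ x, q'.proj (f x) = g (q.proj x)) :
    (coinv k A).map (ModuleCat.ofHom f) ≫ q'.iso.hom = q.iso.hom ≫ ModuleCat.ofHom g := by
  ext x
  obtain ⟨x, rfl⟩ := Submodule.Quotient.mk_surjective _ x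
  exact h x

end CommutatorQuotient

variable {k A}

/-- The chain complex of modules with given differentials. -/
abbrev linComplex {S : Type*} [Ring S] (X : ℕ → Type w) [∀ p, AddCommGroup (X p)]
    [∀ p, Module S (X p)] (d : ∀ p, X (p + 1) →ₗ[S] X p)
    (hd : ∀ p x, d p (d (p + 1) x) = 0) : ChainComplex (ModuleCat.{w} S) ℕ :=
  ChainComplex.of (fun p => ModuleCat.of S (X p)) (fun p => ModuleCat.ofHom (d p))
    (fun p => by ext x; exact hd p x)

theorem linComplex_d {S : Type*} [Ring S] (X : ℕ → Type w) [∀ p, AddCommGroup (X p)]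
    [∀ p, Module S (X p)] (d : ∀ p, X (p + 1) →ₗ[S] X p)
    (hd : ∀ p x, d p (d (p + 1) x) = 0) (p : ℕ) :
    (linComplex X d hd).d (p + 1) p = ModuleCat.ofHom (d p) :=
  ChainComplex.of_d (fun p => ModuleCat.of S (X p)) (fun p => ModuleCat.ofHom (d p)) p

/-- An exact augmented complex of projective modules as a projective resolution. -/
def linResolution {S : Type w} [Ring S] (X : ℕ → Type w) [∀ p, AddCommGroup (X p)]
    [∀ p, Module S (X p)] (hX : ∀ p, Module.Projective S (X p)) (d : ∀ p, X (p + 1) →ₗ[S] X p)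
    (hd : ∀ p x, d p (d (p + 1) x) = 0) {M : Type w} [AddCommGroup M] [Module S M]
    (π : X 0 →ₗ[S] M) (hπd : ∀ x, π (d 0 x) = 0) (hπ : Function.Surjective π)
    (h0 : ∀ x, π x = 0 → ∃ y, d 0 y = x)
    (hex : ∀ p x, d p x = 0 → ∃ y, d (p + 1) y = x) :
    ProjectiveResolution (ModuleCat.of S M) where
  complex := linComplex X d hd
  projective p := (IsProjective.iff_projective _).1 (hX p)
  π := ((linComplex X d hd).toSingle₀Equiv _).symm ⟨ModuleCat.ofHom π, by
    rw [linComplex_d X d hd 0]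
    ext x
    exact hπd x⟩
  quasiIso := ⟨fun m => by
    cases m with
    | zero =>
      -- In degree `0` being a quasi-isomorphism means that `X 1 → X 0 → M → 0` is exact; in higher
      -- degrees the target vanishes and exactness of the complex is left.
      rw [ChainComplex.quasiIsoAt₀_iff, ShortComplex.quasiIso_iff_of_zeros' _ rfl rfl rfl]
      constructor
      · rw [ShortComplex.moduleCat_exact_iff]
        intro x hx
        obtain ⟨y, hy⟩ := h0 x (by simpa using! hx)
        refine ⟨y, ?_⟩
        change (linComplex X d hd).d (0 + 1) 0 y = x
        rw [linComplex_d]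
        exact hy
      · rw [ModuleCat.epi_iff_surjective]
        simpa using! hπ
    | succ m =>
      rw [quasiIsoAt_iff_exactAt' (hL := ChainComplex.exactAt_succ_single_obj ..),
          HomologicalComplex.exactAt_iff' _ (m + 2) (m + 1) m (by simp) (by simp)]
      rw [ShortComplex.moduleCat_exact_iff]
      intro x hx
      change (linComplex X d hd).d (m + 1) m x = 0 at hx
      rw [linComplex_d] at hx
      obtain ⟨y, hy⟩ := hex m x hx
      refine ⟨y, ?_⟩
      change (linComplex X d hd).d (m + 1 + 1) (m + 1) y = x
      rw [linComplex_d]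
      exact hy⟩

/-- The commutator quotient of a complex of bimodules, computed degreewise. -/
def coinvComplexIso (X : ℕ → Type w) [∀ p, AddCommGroup (X p)]
    [∀ p, Module (A ⊗[k] Aᵐᵒᵖ) (X p)] (d : ∀ p, X (p + 1) →ₗ[A ⊗[k] Aᵐᵒᵖ] X p)
    (hd : ∀ p x, d p (d (p + 1) x) = 0) (Y : ℕ → Type w) [∀ p, AddCommGroup (Y p)]
    [∀ p, Module k (Y p)] (b : ∀ p, Y (p + 1) →ₗ[k] Y p)
    (hb : ∀ p x, b p (b (p + 1) x) = 0) (q : ∀ p, CommutatorQuotient k A (X p) (Y p))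
    (hq : ∀ p x, (q p).proj (d p x) = b p ((q (p + 1)).proj x)) :
    ((coinv k A).mapHomologicalComplex _).obj (linComplex X d hd) ≅ linComplex Y b hb :=
  HomologicalComplex.Hom.isoOfComponents (fun p => (q p).iso) (by
    rintro _ p rfl
    simp only [Functor.mapHomologicalComplex_obj_d, ChainComplex.of_d]
    exact ((q (p + 1)).map_comp_iso (q p) (d p) (b p) (hq p)).symm)

/-- The homology of the commutator quotient does not depend on the projective resolution. -/
theorem nonempty_homology_iso {M : Type w} [AddCommGroup M] [Module (A ⊗[k] Aᵐᵒᵖ) M]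
    {K L : ChainComplex (ModuleCat.{w} k) ℕ}
    (P Q : ProjectiveResolution (ModuleCat.of (A ⊗[k] Aᵐᵒᵖ) M))
    (e : ((coinv k A).mapHomologicalComplex _).obj P.complex ≅ K)
    (f : ((coinv k A).mapHomologicalComplex _).obj Q.complex ≅ L) (p : ℕ) :
    Nonempty (K.homology p ≅ L.homology p) :=
  ⟨(HomologicalComplex.homologyMapIso e p).symm ≪≫
    ((coinv k A).mapHomotopyEquiv (P.homotopyEquiv Q)).toHomologyIso p ≪≫
    HomologicalComplex.homologyMapIso f p⟩

end Comparison

end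

end Hochschild

namespace Hochschild

noncomputable section

universe u v

/-! ### Bimodule structure on tensor powers -/

section Bar

variable (k : Type*) (A : Type*) [Field k] [Ring A] [Algebra k A]

/-- Prepending a tensor factor. -/
def consLin (q : ℕ) : A →ₗ[k] (⨂[k] _ : Fin (q + 1), A) →ₗ[k] ⨂[k] _ : Fin (q + 2), A :=
  (PiTensorProduct.lift (R := k) (s := fun _ : Fin (q + 1) => A)).toLinearMap ∘ₗ
    (PiTensorProduct.tprod k (s := fun _ : Fin (q + 2) => A)).curryLeft

/-- Appending a tensor factor. -/
def snocLin (q : ℕ) : A →ₗ[k] (⨂[k] _ : Fin (q + 1), A) →ₗ[k] ⨂[k] _ : Fin (q + 2), A :=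
  (PiTensorProduct.lift (R := k) (s := fun _ : Fin (q + 1) => A)
    (PiTensorProduct.tprod k (s := fun _ : Fin (q + 2) => A)).curryRight).flip

variable {A}

@[simp]
theorem consLin_tprod (q : ℕ) (a : A) (t : Fin (q + 1) → A) :
    consLin k A q a (PiTensorProduct.tprod k t) =
      PiTensorProduct.tprod k (Fin.cons a t : Fin (q + 2) → A) := by
  simp [consLin]

@[simp]
theorem snocLin_tprod (q : ℕ) (a : A) (t : Fin (q + 1) → A) :
    snocLin k A q a (PiTensorProduct.tprod k t) =
      PiTensorProduct.tprod k (Fin.snoc t a : Fin (q + 2) → A) := by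
  simp [snocLin]

theorem faceFun_zero_cons {q : ℕ} (a : A) (t : Fin (q + 1) → A) :
    faceFun 0 (Fin.cons a t : Fin (q + 2) → A) = Function.update t 0 (a * t 0) := by
  funext j
  refine Fin.cases ?_ (fun j => ?_) j
  · simp [faceFun, Fin.ext_iff]
  · simp [faceFun, Fin.ext_iff]

theorem faceFun_last_snoc {q : ℕ} (a : A) (t : Fin (q + 1) → A) :
    faceFun (Fin.last q).castSucc (Fin.snoc t a : Fin (q + 2) → A) =
      Function.update t (Fin.last q) (t (Fin.last q) * a) := by
  funext j
  refine Fin.lastCases ?_ (fun j => ?_) j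
  · have : (Fin.last q).succ = Fin.last (q + 1) := rfl
    simp [faceFun, Fin.ext_iff, this]
  · have h1 : (j : ℕ) ≠ q := j.isLt.ne
    simp [faceFun, Fin.ext_iff, h1]

theorem face_consLin_tprod (q : ℕ) (a : A) (t : Fin (q + 1) → A) :
    face k A q 0 (consLin k A q a (PiTensorProduct.tprod k t)) =
      PiTensorProduct.tprod k (Function.update t 0 (a * t 0)) := by
  rw [consLin_tprod, face_tprod, faceFun_zero_cons]

theorem face_snocLin_tprod (q : ℕ) (a : A) (t : Fin (q + 1) → A) :
    face k A q (Fin.last q).castSucc (snocLin k A q a (PiTensorProduct.tprod k t)) =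
      PiTensorProduct.tprod k (Function.update t (Fin.last q) (t (Fin.last q) * a)) := by
  rw [snocLin_tprod, face_tprod, faceFun_last_snoc]

variable (A)

/-- Left multiplication on the first tensor factor. -/
def leftAct (q : ℕ) : A →ₐ[k] Module.End k (⨂[k] _ : Fin (q + 1), A) :=
  AlgHom.ofLinearMap (LinearMap.llcomp k _ _ _ (face k A q 0) ∘ₗ consLin k A q)
    (PiTensorProduct.ext (MultilinearMap.ext fun t => by
      simp [faceFun_zero_cons]))
    (fun a b => PiTensorProduct.ext (MultilinearMap.ext fun t => by
      simp [-consLin_tprod, face_consLin_tprod, mul_assoc]))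

/-- Right multiplication on the last tensor factor. -/
def rightAct (q : ℕ) : Aᵐᵒᵖ →ₐ[k] Module.End k (⨂[k] _ : Fin (q + 1), A) :=
  AlgHom.ofLinearMap (LinearMap.llcomp k _ _ _ (face k A q (Fin.last q).castSucc) ∘ₗ
      snocLin k A q ∘ₗ (opLinearEquiv k).symm.toLinearMap)
    (PiTensorProduct.ext (MultilinearMap.ext fun t => by
      simp [faceFun_last_snoc]))
    (fun a b => PiTensorProduct.ext (MultilinearMap.ext fun t => by
      simp [-snocLin_tprod, face_snocLin_tprod, mul_assoc]))

variable {A}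

@[simp]
theorem leftAct_tprod (q : ℕ) (a : A) (t : Fin (q + 1) → A) :
    leftAct k A q a (PiTensorProduct.tprod k t) =
      PiTensorProduct.tprod k (Function.update t 0 (a * t 0)) := by
  simp [leftAct, faceFun_zero_cons]

@[simp]
theorem rightAct_tprod (q : ℕ) (a : Aᵐᵒᵖ) (t : Fin (q + 1) → A) :
    rightAct k A q a (PiTensorProduct.tprod k t) =
      PiTensorProduct.tprod k (Function.update t (Fin.last q) (t (Fin.last q) * unop a)) := by
  simp [rightAct, faceFun_last_snoc]

variable (A)

theorem commute_leftAct_rightAct (q : ℕ) (a : A) (b : Aᵐᵒᵖ) :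
    Commute (leftAct k A q a) (rightAct k A q b) := by
  refine PiTensorProduct.ext (MultilinearMap.ext fun t => ?_)
  rcases q with _ | q
  · simp [mul_assoc, Fin.last]
  · have h : (0 : Fin (q + 2)) ≠ Fin.last (q + 1) := (Fin.last_pos).ne
    simp [h, h.symm, Function.update_comm h]

/-- The bimodule structure on the tensor powers of `A`. -/
instance bimodule (q : ℕ) : Module (A ⊗[k] Aᵐᵒᵖ) (⨂[k] _ : Fin (q + 1), A) :=
  Module.compHom _ (Algebra.TensorProduct.lift (leftAct k A q) (rightAct k A q)
    (commute_leftAct_rightAct k A q)).toRingHom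

variable {A}

theorem tmul_smul (q : ℕ) (a : A) (b : Aᵐᵒᵖ) (x : ⨂[k] _ : Fin (q + 1), A) :
    (a ⊗ₜ[k] b : A ⊗[k] Aᵐᵒᵖ) • x = leftAct k A q a (rightAct k A q b x) :=
  LinearMap.congr_fun (Algebra.TensorProduct.lift_tmul (leftAct k A q) (rightAct k A q)
    (commute_leftAct_rightAct k A q) a b) x

theorem algebraMap_smul_tensor (q : ℕ) (c : k) (x : ⨂[k] _ : Fin (q + 1), A) :
    algebraMap k (A ⊗[k] Aᵐᵒᵖ) c • x = c • x :=
  LinearMap.congr_fun ((Algebra.TensorProduct.lift (leftAct k A q) (rightAct k A q)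
    (commute_leftAct_rightAct k A q)).commutes c) x

instance (q : ℕ) : IsScalarTower k (A ⊗[k] Aᵐᵒᵖ) (⨂[k] _ : Fin (q + 1), A) :=
  IsScalarTower.of_algebraMap_smul (algebraMap_smul_tensor k q)

/-- A `k`-linear map of bimodules commuting with both actions is a bimodule map. -/
def bimoduleHom {M N : Type*} [AddCommMonoid M] [AddCommMonoid N] [Module (A ⊗[k] Aᵐᵒᵖ) M]
    [Module (A ⊗[k] Aᵐᵒᵖ) N] (f : M →+ N)
    (hf : ∀ (a : A) (b : Aᵐᵒᵖ) x, f ((a ⊗ₜ[k] b : A ⊗[k] Aᵐᵒᵖ) • x) =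
      (a ⊗ₜ[k] b : A ⊗[k] Aᵐᵒᵖ) • f x) : M →ₗ[A ⊗[k] Aᵐᵒᵖ] N :=
  { f with
    map_smul' := fun r x => by
      change f (r • x) = r • f x
      induction r with
      | zero =>
        exact (congrArg f (zero_smul (A ⊗[k] Aᵐᵒᵖ) x)).trans
          ((map_zero f).trans (zero_smul (A ⊗[k] Aᵐᵒᵖ) (f x)).symm)
      | add r s hr hs =>
        exact (congrArg f (add_smul r s x)).trans
          ((map_add f _ _).trans ((congrArg₂ (· + ·) hr hs).trans (add_smul r s (f x)).symm))
      | tmul a b => exact hf a b x }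

end Bar

end

end Hochschild

namespace Hochschild

noncomputable section

universe u v

/-! ### The bar resolution -/

section BarResolution

variable (k : Type*) (A : Type*) [Field k] [Ring A] [Algebra k A]

theorem faceFun_castSucc {A : Type*} [Mul A] {q : ℕ} (i : Fin (q + 1)) (t : Fin (q + 2) → A) :
    faceFun i.castSucc t = fun j =>
      if j < i then t j.castSucc else if j = i then t j.castSucc * t j.succ else t j.succ := by
  funext j
  have h : i.castSucc ≠ Fin.last (q + 1) := i.castSucc_lt_last.ne
  simp only [faceFun]
  rw [if_neg h]
  simp only [Fin.val_castSucc, Fin.lt_def, Fin.ext_iff]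

theorem faceFun_update_zero {A : Type*} [Semigroup A] {q : ℕ} (i : Fin (q + 1))
    (t : Fin (q + 2) → A) (a : A) :
    faceFun i.castSucc (Function.update t 0 (a * t 0)) =
      Function.update (faceFun i.castSucc t) 0 (a * faceFun i.castSucc t 0) := by
  rw [faceFun_castSucc, faceFun_castSucc]
  funext j
  refine Fin.cases ?_ (fun j => ?_) j
  · have h : (1 : Fin (q + 2)) ≠ 0 := by simp
    by_cases h0 : 0 < i
    · simp [h0]
    · have : i = 0 := by simpa using h0
      subst this
      simp [mul_assoc]
  · simp [Fin.ext_iff]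

theorem faceFun_update_last {A : Type*} [Semigroup A] {q : ℕ} (i : Fin (q + 1))
    (t : Fin (q + 2) → A) (a : A) :
    faceFun i.castSucc (Function.update t (Fin.last (q + 1)) (t (Fin.last (q + 1)) * a)) =
      Function.update (faceFun i.castSucc t) (Fin.last q)
        (faceFun i.castSucc t (Fin.last q) * a) := by
  rw [faceFun_castSucc, faceFun_castSucc]
  funext j
  have h1 : j.castSucc ≠ Fin.last (q + 1) := j.castSucc_lt_last.ne
  by_cases hj : j = Fin.last q
  · subst hj
    have h2 : ¬ Fin.last q < i := not_lt.2 (Fin.le_last i)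
    by_cases h3 : Fin.last q = i
    · subst h3
      simp [mul_assoc]
    · simp [h2, h3]
  · have h2 : j.succ ≠ Fin.last (q + 1) := by simpa [Fin.ext_iff] using hj
    simp [hj, h2]

theorem faceFun_succ_cons {q : ℕ} (i : Fin (q + 1)) (a : A) (t : Fin (q + 2) → A) :
    faceFun i.castSucc.succ (Fin.cons a t : Fin (q + 3) → A) =
      (Fin.cons a (faceFun i.castSucc t) : Fin (q + 2) → A) := by
  rw [← Fin.castSucc_succ, faceFun_castSucc, faceFun_castSucc]
  funext j
  refine Fin.cases ?_ (fun j => ?_) j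
  · simp
  · have h : (Fin.cons a t : Fin (q + 3) → A) j.succ.castSucc = t j.castSucc := rfl
    simp [h, -Fin.castSucc_succ]

/-- The differential of the (augmented) bar resolution. -/
def barDiff (q : ℕ) : (⨂[k] _ : Fin (q + 2), A) →ₗ[k] (⨂[k] _ : Fin (q + 1), A) :=
  ∑ i : Fin (q + 1), (-1 : k) ^ i.val • face k A q i.castSucc

variable {A} in
theorem barDiff_leftAct (q : ℕ) (a : A) (x : ⨂[k] _ : Fin (q + 2), A) :
    barDiff k A q (leftAct k A (q + 1) a x) = leftAct k A q a (barDiff k A q x) := by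
  have h (i : Fin (q + 1)) : face k A q i.castSucc ∘ₗ leftAct k A (q + 1) a =
      leftAct k A q a ∘ₗ face k A q i.castSucc :=
    PiTensorProduct.ext (MultilinearMap.ext fun t => by simp [faceFun_update_zero])
  have h' (i : Fin (q + 1)) := LinearMap.congr_fun (h i) x
  simp only [LinearMap.comp_apply] at h'
  simp [barDiff, h']

variable {A} in
theorem barDiff_rightAct (q : ℕ) (a : Aᵐᵒᵖ) (x : ⨂[k] _ : Fin (q + 2), A) :
    barDiff k A q (rightAct k A (q + 1) a x) = rightAct k A q a (barDiff k A q x) := by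
  have h (i : Fin (q + 1)) : face k A q i.castSucc ∘ₗ rightAct k A (q + 1) a =
      rightAct k A q a ∘ₗ face k A q i.castSucc :=
    PiTensorProduct.ext (MultilinearMap.ext fun t => by simp [faceFun_update_last])
  have h' (i : Fin (q + 1)) := LinearMap.congr_fun (h i) x
  simp only [LinearMap.comp_apply] at h'
  simp [barDiff, h']

/-- The differential of the bar resolution as a bimodule map. -/
def barHom (q : ℕ) :
    (⨂[k] _ : Fin (q + 2), A) →ₗ[A ⊗[k] Aᵐᵒᵖ] (⨂[k] _ : Fin (q + 1), A) :=
  bimoduleHom k (barDiff k A q).toAddMonoidHom fun a b x => by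
    simp [tmul_smul, barDiff_leftAct, barDiff_rightAct]

theorem face_zero_consLin_one (q : ℕ) (x : ⨂[k] _ : Fin (q + 1), A) :
    face k A q 0 (consLin k A q 1 x) = x := by
  have h : face k A q 0 ∘ₗ consLin k A q 1 = LinearMap.id :=
    PiTensorProduct.ext (MultilinearMap.ext fun t => by simp [faceFun_zero_cons])
  exact LinearMap.congr_fun h x

theorem barDiff_zero_consLin (x : ⨂[k] _ : Fin 1, A) :
    barDiff k A 0 (consLin k A 0 1 x) = x := by
  simpa [barDiff] using face_zero_consLin_one k A 0 x

/-- Prepending `1` is a contracting homotopy: face `0` removes the new factor, and each other face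
commutes with prepending after an index shift, which accounts for the sign. -/
theorem barDiff_succ_consLin (q : ℕ) (x : ⨂[k] _ : Fin (q + 2), A) :
    barDiff k A (q + 1) (consLin k A (q + 1) 1 x) = x - consLin k A q 1 (barDiff k A q x) := by
  have h (i : Fin (q + 1)) : face k A (q + 1) i.castSucc.succ ∘ₗ consLin k A (q + 1) 1 =
      consLin k A q 1 ∘ₗ face k A q i.castSucc :=
    PiTensorProduct.ext (MultilinearMap.ext fun t => by simp [faceFun_succ_cons])
  have h' (i : Fin (q + 1)) := LinearMap.congr_fun (h i) x
  simp only [LinearMap.comp_apply] at h'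
  rw [barDiff, LinearMap.sum_apply, Fin.sum_univ_succ]
  simp [h', barDiff, face_zero_consLin_one, pow_succ, sub_eq_add_neg]

/-- A pure tensor is its first entry acting on `1 ⊗` (the remaining entries), so these elements
span. -/
theorem leftAct_consLin_span (q : ℕ) (f : (⨂[k] _ : Fin (q + 2), A) →ₗ[k] ⨂[k] _ : Fin (q), A)
    (h : ∀ a x, f (leftAct k A (q + 1) a (consLin k A q 1 x)) = 0) : f = 0 := by
  refine PiTensorProduct.ext (MultilinearMap.ext fun t => ?_)
  have := h (t 0) (PiTensorProduct.tprod k (Fin.tail t))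
  simpa using this

/-- With `h` prepending `1`, the identity `d h = 1 - h d` gives `d d h = h d d`. By left linearity
and induction this suffices, without any pairing of faces. -/
theorem barDiff_barDiff (q : ℕ) (x : ⨂[k] _ : Fin (q + 3), A) :
    barDiff k A q (barDiff k A (q + 1) x) = 0 := by
  revert x
  suffices h : barDiff k A q ∘ₗ barDiff k A (q + 1) = 0 from
    LinearMap.congr_fun h
  induction q with
  | zero =>
    refine leftAct_consLin_span k A 1 _ fun a x => ?_
    simp [barDiff_leftAct, barDiff_succ_consLin, barDiff_zero_consLin]
  | succ q ih =>
    refine leftAct_consLin_span k A (q + 2) _ fun a x => ?_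
    have ih' := LinearMap.congr_fun ih x
    simp only [LinearMap.comp_apply, LinearMap.zero_apply] at ih'
    simp [barDiff_leftAct, barDiff_succ_consLin, ih']

theorem barDiff_exact (q : ℕ) (x : ⨂[k] _ : Fin (q + 2), A) (hx : barDiff k A q x = 0) :
    barDiff k A (q + 1) (consLin k A (q + 1) 1 x) = x := by
  rw [barDiff_succ_consLin, hx, map_zero, sub_zero]

/-- The outer factors and the inner factors of a tensor. -/
def splitMultilinear (q : ℕ) :
    MultilinearMap k (fun _ : Fin (q + 2) => A) ((A ⊗[k] Aᵐᵒᵖ) ⊗[k] (⨂[k] _ : Fin q, A)) :=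
  have key (t : Fin (q + 2) → A) (m : Fin (q + 2)) :
      ∃ L : A →ₗ[k] (A ⊗[k] Aᵐᵒᵖ) ⊗[k] (⨂[k] _ : Fin q, A), ∀ x,
        (Function.update t m x 0 ⊗ₜ[k] op (Function.update t m x (Fin.last (q + 1)))) ⊗ₜ[k]
          PiTensorProduct.tprod k (fun i : Fin q => Function.update t m x i.castSucc.succ) = L x := by
    have h : Fin.last (q + 1) ≠ 0 := (Fin.last_pos).ne'
    refine Fin.cases ?_ (fun m => ?_) m
    · refine ⟨(TensorProduct.mk k (A ⊗[k] Aᵐᵒᵖ) (⨂[k] _ : Fin q, A)).flip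
        (PiTensorProduct.tprod k (fun i : Fin q => t i.castSucc.succ)) ∘ₗ
        (TensorProduct.mk k A Aᵐᵒᵖ).flip (op (t (Fin.last (q + 1)))), fun x => ?_⟩
      simp [h]
    · refine Fin.lastCases ?_ (fun m => ?_) m
      · refine ⟨(TensorProduct.mk k (A ⊗[k] Aᵐᵒᵖ) (⨂[k] _ : Fin q, A)).flip
          (PiTensorProduct.tprod k (fun i : Fin q => t i.castSucc.succ)) ∘ₗ
          (TensorProduct.mk k A Aᵐᵒᵖ (t 0)) ∘ₗ (opLinearEquiv k).toLinearMap, fun x => ?_⟩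
        have h2 (i : Fin q) : i.castSucc.succ ≠ Fin.last (q + 1) := by
          rw [← Fin.succ_last, Ne, Fin.succ_inj]
          exact i.castSucc_lt_last.ne
        simp [h.symm, h2]
      · refine ⟨(TensorProduct.mk k (A ⊗[k] Aᵐᵒᵖ) (⨂[k] _ : Fin q, A)
          (t 0 ⊗ₜ[k] op (t (Fin.last (q + 1))))) ∘ₗ
          (PiTensorProduct.tprod k).toLinearMap (fun i : Fin q => t i.castSucc.succ) m, fun x => ?_⟩
        have h2 : Fin.last (q + 1) ≠ m.castSucc.succ := by
          rw [← Fin.succ_last, Ne, Fin.succ_inj]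
          exact m.castSucc_lt_last.ne'
        have h3 : (fun i : Fin q => Function.update t m.castSucc.succ x i.castSucc.succ) =
            Function.update (fun i : Fin q => t i.castSucc.succ) m x := by
          funext i
          simp [Function.update_apply]
        rw [h3]
        simp [h2, (Fin.succ_ne_zero _).symm]
  MultilinearMap.mk' (fun t => (t 0 ⊗ₜ[k] op (t (Fin.last (q + 1)))) ⊗ₜ[k]
      PiTensorProduct.tprod k fun i : Fin q => t i.castSucc.succ)
    (fun t m x y => by
      obtain ⟨L, hL⟩ := key t m
      simp only [hL, map_add])
    (fun t m c x => by
      obtain ⟨L, hL⟩ := key t m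
      simp only [hL, map_smul])

theorem splitMultilinear_apply (q : ℕ) (t : Fin (q + 2) → A) :
    splitMultilinear k A q t = (t 0 ⊗ₜ[k] op (t (Fin.last (q + 1)))) ⊗ₜ[k]
      PiTensorProduct.tprod k fun i : Fin q => t i.castSucc.succ := rfl

/-- The inclusion `t ↦ 1 ⊗ t ⊗ 1`. -/
def padMultilinear (q : ℕ) :
    MultilinearMap k (fun _ : Fin q => A) (⨂[k] _ : Fin (q + 2), A) :=
  (LinearMap.applyₗ (1 : A)).compMultilinearMap
    ((PiTensorProduct.tprod k (s := fun _ : Fin (q + 2) => A)).curryLeft 1).curryRight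

theorem padMultilinear_apply (q : ℕ) (t : Fin q → A) :
    padMultilinear k A q t =
      PiTensorProduct.tprod k (Fin.cons 1 (Fin.snoc t 1 : Fin (q + 1) → A) : Fin (q + 2) → A) :=
  rfl

/-- The bimodule map splitting off the inner factors of a tensor. -/
def splitHom (q : ℕ) :
    (⨂[k] _ : Fin (q + 2), A) →ₗ[A ⊗[k] Aᵐᵒᵖ] (A ⊗[k] Aᵐᵒᵖ) ⊗[k] (⨂[k] _ : Fin q, A) :=
  bimoduleHom k (PiTensorProduct.lift (splitMultilinear k A q)).toAddMonoidHom fun a b x => by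
    let f : (⨂[k] _ : Fin (q + 2), A) →ₗ[k] (A ⊗[k] Aᵐᵒᵖ) ⊗[k] (⨂[k] _ : Fin q, A) :=
      PiTensorProduct.lift (splitMultilinear k A q)
    have h : f ∘ₗ leftAct k A (q + 1) a ∘ₗ rightAct k A (q + 1) b =
        (Algebra.lsmul k k _ (a ⊗ₜ[k] b)) ∘ₗ f := by
      refine PiTensorProduct.ext (MultilinearMap.ext fun t => ?_)
      have h : Fin.last (q + 1) ≠ 0 := (Fin.last_pos).ne'
      have h2 (i : Fin q) : i.castSucc.succ ≠ Fin.last (q + 1) := by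
        rw [← Fin.succ_last, Ne, Fin.succ_inj]
        exact i.castSucc_lt_last.ne
      simp [f, splitMultilinear_apply, h, h.symm, h2, TensorProduct.smul_tmul']
    have h' := LinearMap.congr_fun h x
    simp only [LinearMap.comp_apply, ← tmul_smul] at h'
    exact h'

/-- The bimodule map inserting the inner factors of a tensor. -/
def joinHom (q : ℕ) :
    (A ⊗[k] Aᵐᵒᵖ) ⊗[k] (⨂[k] _ : Fin q, A) →ₗ[A ⊗[k] Aᵐᵒᵖ] (⨂[k] _ : Fin (q + 2), A) :=
  haveI : SMulCommClass (A ⊗[k] Aᵐᵒᵖ) k (⨂[k] _ : Fin (q + 2), A) :=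
    (IsScalarTower.to_smulCommClass).symm
  TensorProduct.AlgebraTensorModule.lift
    (LinearMap.toSpanSingleton (A ⊗[k] Aᵐᵒᵖ) _ (PiTensorProduct.lift (padMultilinear k A q)))

theorem joinHom_tmul (q : ℕ) (r : A ⊗[k] Aᵐᵒᵖ) (x : ⨂[k] _ : Fin q, A) :
    joinHom k A q (r ⊗ₜ[k] x) = r • PiTensorProduct.lift (padMultilinear k A q) x := rfl

theorem joinHom_splitHom (q : ℕ) (x : ⨂[k] _ : Fin (q + 2), A) :
    joinHom k A q (splitHom k A q x) = x := by
  have h : (joinHom k A q ∘ₗ splitHom k A q).restrictScalars k = LinearMap.id := by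
    refine PiTensorProduct.ext (MultilinearMap.ext fun t => ?_)
    have h1 : splitHom k A q (PiTensorProduct.tprod k t) = (t 0 ⊗ₜ[k] op (t (Fin.last (q + 1)))) ⊗ₜ[k]
      PiTensorProduct.tprod k fun i : Fin q => t i.castSucc.succ :=
      PiTensorProduct.lift.tprod _
    simp only [LinearMap.compMultilinearMap_apply, LinearMap.restrictScalars_apply,
      LinearMap.comp_apply, h1, joinHom_tmul, PiTensorProduct.lift.tprod, padMultilinear_apply,
      tmul_smul, leftAct_tprod, rightAct_tprod, LinearMap.id_apply]
    congr 1
    funext j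
    refine Fin.cases ?_ (fun j => ?_) j
    · simp [(Fin.last_pos).ne]
    · refine Fin.lastCases ?_ (fun j => ?_) j
      · have e (f : Fin q → A) : (Fin.cons 1 (Fin.snoc f 1 : Fin (q + 1) → A) : Fin (q + 2) → A)
            (Fin.last (q + 1)) = 1 := by
          rw [← Fin.succ_last, Fin.cons_succ, Fin.snoc_last]
        simp [e, (Fin.last_pos).ne']
      · have h2 : j.castSucc.succ ≠ Fin.last (q + 1) := by
          rw [← Fin.succ_last, Ne, Fin.succ_inj]
          exact j.castSucc_lt_last.ne
        simp [h2]
  exact LinearMap.congr_fun h x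

/-- The inner factors form a vector space, so `Aᵉ ⊗ A^{⊗q}` is free over `Aᵉ`, and a retract of it
is projective. -/
theorem projective_tensor (q : ℕ) :
    Module.Projective (A ⊗[k] Aᵐᵒᵖ) (⨂[k] _ : Fin (q + 2), A) :=
  Module.Projective.of_split (splitHom k A q) (joinHom k A q)
    (LinearMap.ext (joinHom_splitHom k A q))

/-- The last face multiplies the last entry by the first one; on either side the merged entry is
`t_last * a * t_0`. -/
theorem face_last_leftAct (q : ℕ) (a : A) (x : ⨂[k] _ : Fin (q + 2), A) :
    face k A q (Fin.last (q + 1)) (leftAct k A (q + 1) a x) =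
      face k A q (Fin.last (q + 1)) (rightAct k A (q + 1) (op a) x) := by
  have h : face k A q (Fin.last (q + 1)) ∘ₗ leftAct k A (q + 1) a =
      face k A q (Fin.last (q + 1)) ∘ₗ rightAct k A (q + 1) (op a) := by
    refine PiTensorProduct.ext (MultilinearMap.ext fun t => ?_)
    simp only [LinearMap.compMultilinearMap_apply, LinearMap.comp_apply, leftAct_tprod,
      rightAct_tprod, face_tprod]
    congr 1
    funext j
    have h : Fin.last (q + 1) ≠ 0 := (Fin.last_pos).ne'
    have h2 : j.castSucc ≠ Fin.last (q + 1) := j.castSucc_lt_last.ne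
    by_cases hj : j = 0
    · simp [faceFun, hj, h, h.symm, mul_assoc]
    · simp [faceFun, hj, h2]
  exact LinearMap.congr_fun h x

theorem face_last_snocLin_one (q : ℕ) (x : ⨂[k] _ : Fin (q + 1), A) :
    face k A q (Fin.last (q + 1)) (snocLin k A q 1 x) = x := by
  have h : face k A q (Fin.last (q + 1)) ∘ₗ snocLin k A q 1 = LinearMap.id := by
    refine PiTensorProduct.ext (MultilinearMap.ext fun t => ?_)
    simp only [LinearMap.compMultilinearMap_apply, LinearMap.comp_apply, snocLin_tprod, face_tprod,
      LinearMap.id_apply]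
    congr 1
    funext j
    by_cases hj : j = 0
    · simp [faceFun, hj]
    · simp [faceFun, hj]
  exact LinearMap.congr_fun h x

/-- The tensor `t` is the right action of its last entry on `(t_0, …, 1)`. Passing through the last
face turns this into the left action of the same entry, so the two differ by a commutator. -/
theorem snocLin_one_face_last (q : ℕ) (t : Fin (q + 2) → A) :
    snocLin k A q 1 (face k A q (Fin.last (q + 1)) (PiTensorProduct.tprod k t)) =
      leftAct k A (q + 1) (t (Fin.last (q + 1)))
        (PiTensorProduct.tprod k (Function.update t (Fin.last (q + 1)) 1)) := by
  rw [face_tprod, snocLin_tprod, leftAct_tprod]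
  congr 1
  funext j
  refine Fin.lastCases ?_ (fun j => ?_) j
  · simp [(Fin.last_pos).ne']
  · have h2 : j.castSucc ≠ Fin.last (q + 1) := j.castSucc_lt_last.ne
    by_cases hj : j = 0
    · subst hj
      simp [faceFun, (Fin.last_pos).ne]
    · have : j.castSucc ≠ 0 := fun h => hj (Fin.castSucc_eq_zero_iff.1 h)
      simp [faceFun, hj, h2, this]

end BarResolution

/-! ### Hochschild homology from an arbitrary projective resolution -/

section Comparison

variable (k : Type u) (A : Type (max u v)) [Field k] [Ring A] [Algebra k A]

/-- The commutator quotient of the bimodule `A^{⊗(q+2)}` is `A^{⊗(q+1)}`. -/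
def barQuotient (q : ℕ) :
    CommutatorQuotient k A (⨂[k] _ : Fin (q + 2), A) (⨂[k] _ : Fin (q + 1), A) where
  proj := (face k A q (Fin.last (q + 1))).toAddMonoidHom
  proj_smul c x := by
    rw [algebraMap_smul_tensor]
    exact (face k A q (Fin.last (q + 1))).map_smul c x
  proj_comm a x := by
    simp [tmul_smul, face_last_leftAct]
  sec := (snocLin k A q 1).toAddMonoidHom
  proj_sec x := face_last_snocLin_one k A q x
  sub_mem x := by
    induction x using PiTensorProduct.induction_on with
    | smul_tprod r t =>
      -- Here `x - sec (proj x)` is a right action minus a left action, the negative of a generator.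
      rw [← neg_mem_iff]
      refine AddSubgroup.subset_closure ⟨t (Fin.last (q + 1)),
        r • PiTensorProduct.tprod k (Function.update t (Fin.last (q + 1)) 1), ?_⟩
      simp [tmul_smul, -face_tprod, snocLin_one_face_last]
    | add x y hx hy =>
      have := add_mem hx hy
      rwa [sub_add_sub_comm, ← map_add, ← map_add] at this

/-- The simplicial identities move the last face past every face of the bar differential. The top
face of the latter becomes the cyclic term of the Hochschild boundary. -/
theorem face_last_barDiff (q : ℕ) (x : ⨂[k] _ : Fin (q + 3), A) :
    face k A q (Fin.last (q + 1)) (barDiff k A (q + 1) x) =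
      boundary k A q (face k A (q + 1) (Fin.last (q + 2)) x) := by
  have h (i : Fin (q + 2)) := LinearMap.congr_fun
    (face_comp_face k A (Fin.last (q + 1)) i.castSucc (Fin.le_last i)) x
  simp only [LinearMap.comp_apply, Fin.succ_last, Fin.castLT_castSucc] at h
  simp [barDiff, boundary, h]

theorem boundary_boundary (q : ℕ) (x : ⨂[k] _ : Fin (q + 3), A) :
    boundary k A q (boundary k A (q + 1) x) = 0 :=
  LinearMap.congr_fun (boundary_comp_boundary k A q) x

/-- The bar resolution. -/
def barResolution :
    ProjectiveResolution (ModuleCat.of (A ⊗[k] Aᵐᵒᵖ) (⨂[k] _ : Fin 1, A)) :=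
  linResolution (fun q => ⨂[k] _ : Fin (q + 2), A) (projective_tensor k A)
    (fun q => barHom k A (q + 1)) (fun q x => barDiff_barDiff k A (q + 1) x) (barHom k A 0)
    (fun x => barDiff_barDiff k A 0 x) (fun x => ⟨_, barDiff_zero_consLin k A x⟩)
    (fun x hx => ⟨_, barDiff_exact k A 0 x hx⟩) (fun q x hx => ⟨_, barDiff_exact k A (q + 1) x hx⟩)

/-- Hochschild homology is computed by any projective resolution of the bimodule `A`. -/
theorem nonempty_HH_iso (X : ℕ → Type (max u v)) [∀ p, AddCommGroup (X p)]
    [∀ p, Module (A ⊗[k] Aᵐᵒᵖ) (X p)] (hX : ∀ p, Module.Projective (A ⊗[k] Aᵐᵒᵖ) (X p))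
    (d : ∀ p, X (p + 1) →ₗ[A ⊗[k] Aᵐᵒᵖ] X p) (hd : ∀ p x, d p (d (p + 1) x) = 0)
    (π : X 0 →ₗ[A ⊗[k] Aᵐᵒᵖ] (⨂[k] _ : Fin 1, A)) (hπd : ∀ x, π (d 0 x) = 0)
    (hπ : Function.Surjective π) (h0 : ∀ x, π x = 0 → ∃ y, d 0 y = x)
    (hex : ∀ p x, d p x = 0 → ∃ y, d (p + 1) y = x)
    (Y : ℕ → Type (max u v)) [∀ p, AddCommGroup (Y p)] [∀ p, Module k (Y p)]
    (b : ∀ p, Y (p + 1) →ₗ[k] Y p) (hb : ∀ p x, b p (b (p + 1) x) = 0)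
    (q : ∀ p, CommutatorQuotient k A (X p) (Y p))
    (hq : ∀ p x, (q p).proj (d p x) = b p ((q (p + 1)).proj x)) (p : ℕ) :
    Nonempty (HH k A p ≅ (linComplex Y b hb).homology p) :=
  nonempty_homology_iso (barResolution k A) (linResolution X hX d hd π hπd hπ h0 hex)
    (coinvComplexIso (fun q => ⨂[k] _ : Fin (q + 2), A) (fun q => barHom k A (q + 1))
      (fun q x => barDiff_barDiff k A (q + 1) x) (fun q => ⨂[k] _ : Fin (q + 1), A)
      (boundary k A) (boundary_boundary k A) (barQuotient k A) (face_last_barDiff k A))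
    (coinvComplexIso X d hd Y b hb q hq) p

end Comparison

end

end Hochschild

/-! ### The enveloping algebra of a truncated cycle and its contracting maps -/

/-- The data of a truncated cycle algebra: vertex idempotents `e i` and the sum `x` of all arrows,
such that the products `e i * x ^ a` with `a < n` form a basis and `x ^ n = 0`. -/
structure TruncatedCycle (k A : Type*) [Field k] [Ring A] [Algebra k A] (l n : ℕ) [NeZero l] where
  /-- The vertex idempotents. -/
  e : ZMod l → A
  /-- The sum of the arrows. -/
  x : A
  /-- The basis of paths. -/
  basis : Module.Basis (ZMod l × Fin n) k A
  basis_apply : ∀ i a, basis (i, a) = e i * x ^ (a : ℕ)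
  e_mul_e : ∀ i j, e i * e j = if i = j then e i else 0
  sum_e : ∑ i, e i = 1
  e_mul_x : ∀ i, e i * x = x * e (i + 1)
  x_pow : x ^ n = 0

namespace TruncatedCycle

noncomputable section

section Env

variable {k A : Type*} [Field k] [Ring A] [Algebra k A] {l n : ℕ} [NeZero l]
  (T : TruncatedCycle k A l n)

theorem e_mul_x_pow (i : ZMod l) (a : ℕ) : T.e i * T.x ^ a = T.x ^ a * T.e (i + a) := by
  induction a with
  | zero => simp
  | succ a ih => rw [pow_succ, ← mul_assoc, ih, mul_assoc, T.e_mul_x, ← mul_assoc]; simp [add_assoc]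

theorem x_pow_eq_zero {a : ℕ} (h : n ≤ a) : T.x ^ a = 0 := pow_eq_zero_of_le h T.x_pow

/-- The idempotent `∑ e_i ⊗ e_{i+m}` of the enveloping algebra. -/
def eps (m : ZMod l) : A ⊗[k] Aᵐᵒᵖ := ∑ i, T.e i ⊗ₜ[k] op (T.e (i + m))

/-- The element `x ⊗ 1` of the enveloping algebra. -/
def z₁ : A ⊗[k] Aᵐᵒᵖ := T.x ⊗ₜ[k] 1

/-- The element `1 ⊗ x` of the enveloping algebra. -/
def z₂ : A ⊗[k] Aᵐᵒᵖ := 1 ⊗ₜ[k] op T.x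

theorem tmul_mul_eps (m : ZMod l) (a : A) (b : Aᵐᵒᵖ) :
    (a ⊗ₜ[k] b) * T.eps m = ∑ i, (a * T.e i) ⊗ₜ[k] (b * op (T.e (i + m))) := by
  simp [eps, Finset.mul_sum]

theorem eps_mul_eps (m : ZMod l) : T.eps m * T.eps m = T.eps m := by
  conv_lhs => enter [1]; rw [eps]
  rw [Finset.sum_mul]
  refine Finset.sum_congr rfl fun i _ => ?_
  rw [tmul_mul_eps, Finset.sum_eq_single i]
  · simp [T.e_mul_e, ← op_mul]
  · intro j _ hj
    simp [T.e_mul_e, hj.symm]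
  · simp

theorem commute_z : Commute T.z₁ T.z₂ := by
  simp [Commute, SemiconjBy, z₁, z₂]

theorem z₁_pow (a : ℕ) : T.z₁ ^ a = (T.x ^ a) ⊗ₜ[k] 1 := by
  simp [z₁, Algebra.TensorProduct.tmul_pow]

theorem z₂_pow (a : ℕ) : T.z₂ ^ a = 1 ⊗ₜ[k] op (T.x ^ a) := by
  simp [z₂, Algebra.TensorProduct.tmul_pow]

/-- `Aᵉ * eps m` is the sum of the `A e_i ⊗ e_{i+m} A`, with a gap of `m` between the factors. Right
multiplication by `z₁` fills one step of the gap from the left, moving `i` to `i + 1`; hence the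
reindexing of the sum. -/
theorem eps_mul_z₁ (m : ZMod l) : T.eps (m + 1) * T.z₁ = T.z₁ * T.eps m := by
  rw [z₁, tmul_mul_eps, eps, Finset.sum_mul]
  refine (Finset.sum_congr rfl fun i _ => ?_).trans (Equiv.sum_comp (Equiv.addRight (1 : ZMod l))
    fun i => (T.x * T.e i) ⊗ₜ[k] ((1 : Aᵐᵒᵖ) * op (T.e (i + m))))
  simp [T.e_mul_x, add_assoc, add_comm m]

theorem eps_mul_z₂ (m : ZMod l) : T.eps (m + 1) * T.z₂ = T.z₂ * T.eps m := by
  rw [z₂, tmul_mul_eps, eps, Finset.sum_mul]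
  refine Finset.sum_congr rfl fun i _ => ?_
  simp [← op_mul, T.e_mul_x, add_assoc]

theorem eps_mul_z₁_pow (m : ZMod l) (a : ℕ) : T.eps (m + a) * T.z₁ ^ a = T.z₁ ^ a * T.eps m := by
  induction a generalizing m with
  | zero => simp
  | succ a ih =>
    rw [pow_succ, ← mul_assoc, Nat.cast_succ, add_comm (a : ZMod l), ← add_assoc, ih, mul_assoc,
      eps_mul_z₁, mul_assoc]

theorem eps_mul_z₂_pow (m : ZMod l) (a : ℕ) : T.eps (m + a) * T.z₂ ^ a = T.z₂ ^ a * T.eps m := by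
  induction a generalizing m with
  | zero => simp
  | succ a ih =>
    rw [pow_succ, ← mul_assoc, Nat.cast_succ, add_comm (a : ZMod l), ← add_assoc, ih, mul_assoc,
      eps_mul_z₂, mul_assoc]

/-- The sums `∑ t < a, x ^ t ⊗ x ^ (a - 1 - t)`. -/
def geom (a : ℕ) : A ⊗[k] Aᵐᵒᵖ := ∑ t ∈ Finset.range a, T.z₁ ^ t * T.z₂ ^ (a - 1 - t)

theorem eps_mul_geom (m : ZMod l) (a : ℕ) :
    T.eps (m + (a - 1 : ℕ)) * T.geom a = T.geom a * T.eps m := by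
  rw [geom, Finset.mul_sum, Finset.sum_mul]
  refine Finset.sum_congr rfl fun t ht => ?_
  have ht : t < a := Finset.mem_range.1 ht
  have h : m + ((a - 1 : ℕ) : ZMod l) = m + ((a - 1 - t : ℕ) : ZMod l) + (t : ZMod l) := by
    rw [add_assoc, ← Nat.cast_add]
    congr 2
    omega
  rw [h, ← mul_assoc, eps_mul_z₁_pow, mul_assoc, eps_mul_z₂_pow, mul_assoc]

theorem geom_mul_sub (a : ℕ) : T.geom a * (T.z₁ - T.z₂) = T.z₁ ^ a - T.z₂ ^ a :=
  T.commute_z.geom_sum₂_mul a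

theorem sub_mul_geom (a : ℕ) : (T.z₁ - T.z₂) * T.geom a = T.z₁ ^ a - T.z₂ ^ a :=
  T.commute_z.mul_geom_sum₂ a

theorem geom_succ (a : ℕ) : T.geom (a + 1) = T.z₁ ^ a + T.z₂ * T.geom a := by
  rw [geom, Finset.sum_range_succ, add_comm, geom, Finset.mul_sum]
  congr 1
  · simp
  · refine Finset.sum_congr rfl fun t ht => ?_
    have ht : t < a := Finset.mem_range.1 ht
    rw [show a + 1 - 1 - t = a - 1 - t + 1 by omega, pow_succ', ← mul_assoc, ← mul_assoc,
      (T.commute_z.symm.pow_right t).eq]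

theorem z₁_pow_eq_zero {a : ℕ} (h : n ≤ a) : T.z₁ ^ a = 0 := by
  rw [z₁_pow, T.x_pow_eq_zero h, TensorProduct.zero_tmul]

theorem z₂_pow_eq_zero {a : ℕ} (h : n ≤ a) : T.z₂ ^ a = 0 := by
  rw [z₂_pow, T.x_pow_eq_zero h, op_zero, TensorProduct.tmul_zero]

/-- The linear map with `(e_i ⊗ w) z₁ ^ a ↦ (e_i ⊗ w) f a` for `a < n`. -/
def shiftMap (f : ℕ → A ⊗[k] Aᵐᵒᵖ) : A ⊗[k] Aᵐᵒᵖ →ₗ[k] A ⊗[k] Aᵐᵒᵖ :=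
  TensorProduct.lift (T.basis.constr k fun p =>
    LinearMap.mulRight k (f p.2) ∘ₗ TensorProduct.mk k A Aᵐᵒᵖ (T.e p.1))

theorem shiftMap_apply (f : ℕ → A ⊗[k] Aᵐᵒᵖ) (i : ZMod l) (w : Aᵐᵒᵖ) {a : ℕ} (ha : a < n) :
    T.shiftMap f ((T.e i ⊗ₜ[k] w) * T.z₁ ^ a) = (T.e i ⊗ₜ[k] w) * f a := by
  have h : (T.e i ⊗ₜ[k] w) * T.z₁ ^ a = (T.basis (i, ⟨a, ha⟩)) ⊗ₜ[k] w := by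
    rw [z₁_pow, T.basis_apply]
    simp
  rw [h, shiftMap, TensorProduct.lift.tmul, Module.Basis.constr_basis]
  rfl

/-- Since the `e i * x ^ a` with `a < n` span `A`, these elements span `Aᵉ`. Identities between
linear maps thereby reduce to polynomial identities in the commuting elements `z₁` and `z₂`. -/
theorem env_ext {M : Type*} [AddCommGroup M] [Module k M] {f g : A ⊗[k] Aᵐᵒᵖ →ₗ[k] M}
    (h : ∀ (i : ZMod l) (w : Aᵐᵒᵖ) (a : ℕ), a < n →
      f ((T.e i ⊗ₜ[k] w) * T.z₁ ^ a) = g ((T.e i ⊗ₜ[k] w) * T.z₁ ^ a)) : f = g := by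
  refine TensorProduct.ext (T.basis.ext fun p => LinearMap.ext fun w => ?_)
  have := h p.1 w p.2 p.2.isLt
  rw [z₁_pow] at this
  simpa [T.basis_apply] using this

theorem tmul_mul_z₂_pow (i : ZMod l) (w : Aᵐᵒᵖ) (b : ℕ) :
    (T.e i ⊗ₜ[k] w) * T.z₂ ^ b = T.e i ⊗ₜ[k] (w * op (T.x ^ b)) := by
  rw [z₂_pow]
  simp

/-- The first contracting map. -/
def contr₀ : A ⊗[k] Aᵐᵒᵖ →ₗ[k] A ⊗[k] Aᵐᵒᵖ := T.shiftMap T.geom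

/-- The second contracting map. -/
def contr₁ : A ⊗[k] Aᵐᵒᵖ →ₗ[k] A ⊗[k] Aᵐᵒᵖ := T.shiftMap fun a => if a + 1 = n then 1 else 0

/-- The map moving the powers of `x` to the right factor. -/
def moveMap : A ⊗[k] Aᵐᵒᵖ →ₗ[k] A ⊗[k] Aᵐᵒᵖ := T.shiftMap fun a => T.z₂ ^ a

theorem contr₀_mul (r : A ⊗[k] Aᵐᵒᵖ) : T.contr₀ r * (T.z₁ - T.z₂) = r - T.moveMap r := by
  have h : LinearMap.mulRight k (T.z₁ - T.z₂) ∘ₗ T.contr₀ = LinearMap.id - T.moveMap := by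
    refine T.env_ext fun i w a ha => ?_
    simp only [LinearMap.comp_apply, contr₀, T.shiftMap_apply _ _ _ ha, LinearMap.mulRight_apply,
      LinearMap.sub_apply, LinearMap.id_apply, moveMap]
    rw [mul_assoc, geom_mul_sub, mul_sub]
  exact LinearMap.congr_fun h r

/-- For `a < n - 1` this is `geom (a + 1) - z₂ * geom a = z₁ ^ a`. For `a = n - 1` the term `z₁ ^ n`
vanishes, so `geom n` is missing and `contr₁` supplies it. -/
theorem contr₀_add_contr₁ (r : A ⊗[k] Aᵐᵒᵖ) :
    T.contr₀ (r * (T.z₁ - T.z₂)) + T.contr₁ r * T.geom n = r := by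
  have h : T.contr₀ ∘ₗ LinearMap.mulRight k (T.z₁ - T.z₂) +
      LinearMap.mulRight k (T.geom n) ∘ₗ T.contr₁ = LinearMap.id := by
    refine T.env_ext fun i w a ha => ?_
    -- The factor `z₂` is absorbed into `w`, which restores the form on which `shiftMap` is defined.
    have h1 : T.e i ⊗ₜ[k] w * T.z₁ ^ a * T.z₂ = T.e i ⊗ₜ[k] (w * op (T.x ^ 1)) * T.z₁ ^ a := by
      rw [mul_assoc, (T.commute_z.pow_left a).eq, ← mul_assoc, ← tmul_mul_z₂_pow, pow_one]
    simp only [LinearMap.add_apply, LinearMap.comp_apply, LinearMap.mulRight_apply,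
      LinearMap.id_apply, mul_sub, map_sub, contr₁, T.shiftMap_apply _ _ _ ha, h1]
    rw [contr₀, T.shiftMap_apply _ _ _ ha, ← tmul_mul_z₂_pow, pow_one, mul_assoc _ (T.z₁ ^ a),
      ← pow_succ]
    by_cases hn : a + 1 = n
    · subst hn
      rw [T.z₁_pow_eq_zero le_rfl, if_pos rfl, geom_succ]
      simp [mul_add, mul_assoc]
    · rw [T.shiftMap_apply _ _ _ (by omega : a + 1 < n), if_neg hn, geom_succ]
      simp [mul_add, mul_assoc]
  exact LinearMap.congr_fun h r

theorem contr₁_mul_geom (r : A ⊗[k] Aᵐᵒᵖ) : T.contr₁ (r * T.geom n) = T.moveMap r := by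
  have h : T.contr₁ ∘ₗ LinearMap.mulRight k (T.geom n) = T.moveMap := by
    refine T.env_ext fun i w a ha => ?_
    have h1 (t : ℕ) : T.contr₁ (T.e i ⊗ₜ[k] w * T.z₁ ^ a * (T.z₁ ^ t * T.z₂ ^ (n - 1 - t))) =
        if a + t + 1 = n then T.e i ⊗ₜ[k] w * T.z₂ ^ (n - 1 - t) else 0 := by
      rw [mul_assoc, ← mul_assoc (T.z₁ ^ a), ← pow_add, (T.commute_z.pow_pow _ _).eq, ← mul_assoc,
        tmul_mul_z₂_pow]
      by_cases h2 : a + t < n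
      · rw [contr₁, T.shiftMap_apply _ _ _ h2]
        split_ifs <;> simp
      · rw [T.z₁_pow_eq_zero (not_lt.1 h2), if_neg (by omega)]
        simp
    simp only [LinearMap.comp_apply, LinearMap.mulRight_apply, moveMap, T.shiftMap_apply _ _ _ ha]
    -- `contr₁` detects only the power `z₁ ^ (n - 1)`, so just the term `a + t = n - 1` of `geom n`
    -- survives, and it leaves `z₂ ^ a`.
    rw [geom, Finset.mul_sum, map_sum, Finset.sum_congr rfl fun t _ => h1 t,
      Finset.sum_eq_single (n - 1 - a)]
    · rw [if_pos (by omega)]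
      congr 2
      omega
    · intro t _ ht
      rw [if_neg (by omega)]
    · intro ht
      exact absurd (Finset.mem_range.2 (by omega)) ht
  exact LinearMap.congr_fun h r

/-- The section `y ↦ ∑ e_i ⊗ e_i y` of the multiplication. -/
def diagMap : A →ₗ[k] A ⊗[k] Aᵐᵒᵖ :=
  ∑ i, TensorProduct.mk k A Aᵐᵒᵖ (T.e i) ∘ₗ (opLinearEquiv k).toLinearMap ∘ₗ
    LinearMap.mulLeft k (T.e i)

/-- Once every power of `x` sits on the right, cutting by `eps 0` leaves `e_i ⊗ e_i y`, which
depends only on the product `e_i y` of the two factors. This gives exactness at the augmentation. -/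
theorem moveMap_mul_eps :
    LinearMap.mulRight k (T.eps 0) ∘ₗ T.moveMap =
      T.diagMap ∘ₗ LinearMap.mul' k A ∘ₗ
        (TensorProduct.map LinearMap.id (opLinearEquiv k).symm.toLinearMap) := by
  refine T.env_ext fun i w a ha => ?_
  simp only [LinearMap.comp_apply, moveMap, T.shiftMap_apply _ _ _ ha, LinearMap.mulRight_apply]
  rw [tmul_mul_z₂_pow, tmul_mul_eps, z₁_pow, Finset.sum_eq_single i]
  · rw [diagMap, LinearMap.sum_apply, Finset.sum_eq_single i]
    · simp [T.e_mul_e, ← mul_assoc]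
    · intro j _ hj
      simp [T.e_mul_e, hj, ← mul_assoc]
    · simp
  · intro j _ hj
    simp [T.e_mul_e, hj.symm]
  · simp

end Env

end

end TruncatedCycle

/-! ### The small projective resolution -/

namespace TruncatedCycle

noncomputable section

open Hochschild

section Shift

variable {l n : ℕ}

/-- The lengths of the relations: `c n` in degree `2c` and `c n + 1` in degree `2c + 1`. -/
def shift (l n p : ℕ) : ZMod l := ((p / 2 * n + p % 2 : ℕ) : ZMod l)

theorem shift_succ_of_even {p : ℕ} (hp : Even p) : shift l n (p + 1) = shift l n p + 1 := by
  obtain ⟨c, rfl⟩ := hp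
  simp only [shift]
  rw [show (c + c) / 2 = c by omega, show (c + c + 1) / 2 = c by omega,
    show (c + c) % 2 = 0 by omega, show (c + c + 1) % 2 = 1 by omega]
  push_cast
  ring

theorem shift_succ_of_odd (hn : 1 ≤ n) {p : ℕ} (hp : ¬ Even p) :
    shift l n (p + 1) = shift l n p + (n - 1 : ℕ) := by
  obtain ⟨c, rfl⟩ := Nat.not_even_iff_odd.1 hp
  simp only [shift]
  rw [show (2 * c + 1) / 2 = c by omega, show (2 * c + 1 + 1) / 2 = c + 1 by omega,
    show (2 * c + 1) % 2 = 1 by omega, show (2 * c + 1 + 1) % 2 = 0 by omega, Nat.cast_sub hn]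
  push_cast
  ring

end Shift

section Resolution

variable {k A : Type*} [Field k] [Ring A] [Algebra k A] {l n : ℕ} [NeZero l]
  (T : TruncatedCycle k A l n)

/-- The left ideal generated by the idempotent `eps m`. -/
def leftIdeal (m : ZMod l) : Submodule (A ⊗[k] Aᵐᵒᵖ) (A ⊗[k] Aᵐᵒᵖ) where
  carrier := {r | r * T.eps m = r}
  add_mem' {r s} hr hs := by
    change (r + s) * T.eps m = r + s
    rw [add_mul, hr, hs]
  zero_mem' := zero_mul _
  smul_mem' c r hr := by
    change c * r * T.eps m = c * r
    rw [mul_assoc, hr]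

theorem mem_leftIdeal {m : ZMod l} {r : A ⊗[k] Aᵐᵒᵖ} : r ∈ T.leftIdeal m ↔ r * T.eps m = r :=
  Iff.rfl

theorem mul_eps_mem (m : ZMod l) (r : A ⊗[k] Aᵐᵒᵖ) : r * T.eps m ∈ T.leftIdeal m := by
  rw [mem_leftIdeal, mul_assoc, eps_mul_eps]

theorem projective_leftIdeal (m : ZMod l) :
    Module.Projective (A ⊗[k] Aᵐᵒᵖ) (T.leftIdeal m) :=
  Module.Projective.of_split (T.leftIdeal m).subtype
    ((LinearMap.toSpanSingleton (A ⊗[k] Aᵐᵒᵖ) _ (T.eps m)).codRestrict _ (T.mul_eps_mem m))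
    (LinearMap.ext fun r => Subtype.ext r.2)

/-- The elements defining the differentials of the minimal resolution. -/
def diffElt (p : ℕ) : A ⊗[k] Aᵐᵒᵖ := if Even p then T.z₁ - T.z₂ else T.geom n

/-- `z₁ - z₂` has degree `1` and `geom n` has degree `n - 1`; these are the successive differences
of `shift`. -/
theorem eps_mul_diffElt (hn : 1 ≤ n) (p : ℕ) :
    T.eps (shift l n (p + 1)) * T.diffElt p = T.diffElt p * T.eps (shift l n p) := by
  by_cases hp : Even p
  · rw [diffElt, if_pos hp, shift_succ_of_even hp, mul_sub, sub_mul, eps_mul_z₁, eps_mul_z₂]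
  · rw [diffElt, if_neg hp, shift_succ_of_odd hn hp, eps_mul_geom]

theorem diffElt_mul_diffElt (p : ℕ) : T.diffElt (p + 1) * T.diffElt p = 0 := by
  by_cases hp : Even p
  · rw [diffElt, diffElt, if_pos hp, if_neg (by simpa [Nat.even_add_one] using hp), geom_mul_sub,
      T.z₁_pow_eq_zero le_rfl, T.z₂_pow_eq_zero le_rfl, sub_zero]
  · rw [diffElt, diffElt, if_neg hp, if_pos (by simpa [Nat.even_add_one] using hp), sub_mul_geom,
      T.z₁_pow_eq_zero le_rfl, T.z₂_pow_eq_zero le_rfl, sub_zero]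

theorem mul_diffElt_mem (hn : 1 ≤ n) (p : ℕ) (r : T.leftIdeal (shift l n (p + 1))) :
    (r : A ⊗[k] Aᵐᵒᵖ) * T.diffElt p ∈ T.leftIdeal (shift l n p) := by
  rw [mem_leftIdeal, mul_assoc, ← T.eps_mul_diffElt hn, ← mul_assoc, r.2]

/-- The differential of the minimal resolution. -/
def resDiff (hn : 1 ≤ n) (p : ℕ) :
    T.leftIdeal (shift l n (p + 1)) →ₗ[A ⊗[k] Aᵐᵒᵖ] T.leftIdeal (shift l n p) :=
  (LinearMap.toSpanSingleton (A ⊗[k] Aᵐᵒᵖ) _ (T.diffElt p) ∘ₗ Submodule.subtype _).codRestrict _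
    (T.mul_diffElt_mem hn p)

theorem coe_resDiff (hn : 1 ≤ n) (p : ℕ) (r : T.leftIdeal (shift l n (p + 1))) :
    (T.resDiff hn p r : A ⊗[k] Aᵐᵒᵖ) = r * T.diffElt p := rfl

theorem resDiff_resDiff (hn : 1 ≤ n) (p : ℕ) (r : T.leftIdeal (shift l n (p + 1 + 1))) :
    T.resDiff hn p (T.resDiff hn (p + 1) r) = 0 := by
  refine Subtype.ext ?_
  rw [coe_resDiff, coe_resDiff, mul_assoc, diffElt_mul_diffElt, mul_zero]
  rfl

/-- The contractions need not preserve the left ideals. Cutting their value by the idempotent in the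
source is harmless, since `diffElt` intertwines the idempotents. -/
theorem exists_resDiff_eq (hn : 1 ≤ n) (p : ℕ) (r : T.leftIdeal (shift l n p))
    (s : A ⊗[k] Aᵐᵒᵖ) (h : s * T.diffElt p * T.eps (shift l n p) = r) :
    ∃ y, T.resDiff hn p y = r := by
  refine ⟨⟨s * T.eps (shift l n (p + 1)), T.mul_eps_mem _ _⟩, Subtype.ext ?_⟩
  rw [coe_resDiff, mul_assoc, T.eps_mul_diffElt hn, ← mul_assoc, h]

theorem resDiff_exact (hn : 1 ≤ n) (p : ℕ) (r : T.leftIdeal (shift l n (p + 1)))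
    (hr : T.resDiff hn p r = 0) : ∃ y, T.resDiff hn (p + 1) y = r := by
  have hr' : (r : A ⊗[k] Aᵐᵒᵖ) * T.diffElt p = 0 := congrArg Subtype.val hr
  by_cases hp : Even p
  · rw [diffElt, if_pos hp] at hr'
    refine T.exists_resDiff_eq hn _ r (T.contr₁ r) ?_
    have h := T.contr₀_add_contr₁ (r : A ⊗[k] Aᵐᵒᵖ)
    rw [hr', map_zero, zero_add] at h
    rw [diffElt, if_neg (by simpa [Nat.even_add_one] using hp), h, r.2]
  · rw [diffElt, if_neg hp] at hr'
    refine T.exists_resDiff_eq hn _ r (T.contr₀ r) ?_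
    -- The error term `moveMap r` equals `contr₁ (r * geom n)`, which vanishes on the kernel.
    rw [diffElt, if_pos (by simpa [Nat.even_add_one] using hp), contr₀_mul, ← contr₁_mul_geom, hr',
      map_zero, sub_zero, r.2]

/-- The augmentation of the minimal resolution. -/
def resAug (m : ZMod l) : T.leftIdeal m →ₗ[A ⊗[k] Aᵐᵒᵖ] (⨂[k] _ : Fin 1, A) :=
  LinearMap.toSpanSingleton (A ⊗[k] Aᵐᵒᵖ) _ (PiTensorProduct.tprod k fun _ => (1 : A)) ∘ₗ
    Submodule.subtype _

theorem resAug_apply (m : ZMod l) (r : T.leftIdeal m) :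
    T.resAug m r = (r : A ⊗[k] Aᵐᵒᵖ) • PiTensorProduct.tprod k fun _ => (1 : A) := rfl

variable (k A) in
theorem tmul_smul_one (a : A) (b : Aᵐᵒᵖ) :
    (a ⊗ₜ[k] b : A ⊗[k] Aᵐᵒᵖ) • (PiTensorProduct.tprod k fun _ : Fin 1 => (1 : A)) =
      PiTensorProduct.tprod k fun _ : Fin 1 => a * unop b := by
  rw [tmul_smul, rightAct_tprod, leftAct_tprod]
  congr 1
  funext j
  refine Fin.cases ?_ (fun j => j.elim0) j
  simp [Fin.last]

variable (k A) in
theorem subsingletonEquiv_smul_one (r : A ⊗[k] Aᵐᵒᵖ) :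
    PiTensorProduct.subsingletonEquiv (0 : Fin 1)
        (r • (PiTensorProduct.tprod k fun _ : Fin 1 => (1 : A))) =
      LinearMap.mul' k A (TensorProduct.map LinearMap.id (opLinearEquiv k).symm.toLinearMap r) := by
  have h : (PiTensorProduct.subsingletonEquiv (0 : Fin 1)).toLinearMap ∘ₗ
      (LinearMap.toSpanSingleton (A ⊗[k] Aᵐᵒᵖ) _
        (PiTensorProduct.tprod k fun _ : Fin 1 => (1 : A))).restrictScalars k =
      LinearMap.mul' k A ∘ₗ TensorProduct.map LinearMap.id (opLinearEquiv k).symm.toLinearMap := by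
    refine TensorProduct.ext' fun a b => ?_
    simp [tmul_smul_one]
  exact LinearMap.congr_fun h r

theorem resAug_resDiff (hn : 1 ≤ n) (r : T.leftIdeal (shift l n (0 + 1))) :
    T.resAug _ (T.resDiff hn 0 r) = 0 := by
  rw [resAug_apply, coe_resDiff, diffElt, if_pos (by simp), mul_smul, sub_smul, z₁, z₂,
    tmul_smul_one, tmul_smul_one]
  simp

theorem resAug_surjective : Function.Surjective (T.resAug (shift l n 0)) := by
  intro t
  -- The preimage of `y` is `∑ y e_i ⊗ e_i`, whose product is `y * ∑ e_i = y`.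
  refine ⟨⟨_, T.mul_eps_mem _ ((PiTensorProduct.subsingletonEquiv (0 : Fin 1) t) ⊗ₜ[k] 1)⟩, ?_⟩
  change (_ * T.eps _) • _ = t
  rw [tmul_mul_eps, Finset.sum_smul]
  apply (PiTensorProduct.subsingletonEquiv (0 : Fin 1)).injective
  simp [tmul_smul_one, shift, mul_assoc, T.e_mul_e, ← Finset.mul_sum, T.sum_e]

theorem resAug_exact (hn : 1 ≤ n) (r : T.leftIdeal (shift l n 0)) (hr : T.resAug _ r = 0) :
    ∃ y, T.resDiff hn 0 y = r := by
  refine T.exists_resDiff_eq hn _ r (T.contr₀ r) ?_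
  have h := LinearMap.congr_fun T.moveMap_mul_eps (r : A ⊗[k] Aᵐᵒᵖ)
  simp only [LinearMap.comp_apply] at h
  rw [← subsingletonEquiv_smul_one, ← resAug_apply, hr, map_zero, map_zero,
    LinearMap.mulRight_apply] at h
  have h0 : shift l n 0 = 0 := by simp [shift]
  have hr2 := r.2
  rw [mem_leftIdeal] at hr2
  have h1 : T.moveMap r * T.eps (shift l n 0) = 0 :=
    (congrArg (fun m => T.moveMap r * T.eps m) h0).trans h
  rw [diffElt, if_pos (by simp), contr₀_mul, sub_mul, hr2, h1, sub_zero]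

end Resolution

end

end TruncatedCycle

/-! ### The commutator quotient of the small resolution -/

namespace TruncatedCycle

noncomputable section

open Hochschild

universe u v

section Coinvariants

variable {k A : Type*} [Field k] [Ring A] [Algebra k A] {l n : ℕ} [NeZero l]
  (T : TruncatedCycle k A l n)

variable (k A) in
/-- The map `a ⊗ b ↦ b a`. -/
def swapMul : A ⊗[k] Aᵐᵒᵖ →ₗ[k] A :=
  LinearMap.mul' k A ∘ₗ (TensorProduct.comm k A A).toLinearMap ∘ₗ
    TensorProduct.map LinearMap.id (opLinearEquiv k).symm.toLinearMap

variable (k A) in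
@[simp]
theorem swapMul_tmul (a : A) (b : Aᵐᵒᵖ) : swapMul k A (a ⊗ₜ[k] b) = unop b * a := by
  simp [swapMul]

variable (k) in
theorem swapMul_comm (a : A) (r : A ⊗[k] Aᵐᵒᵖ) :
    swapMul k A ((a ⊗ₜ[k] 1) * r) = swapMul k A ((1 ⊗ₜ[k] op a) * r) := by
  have h : swapMul k A ∘ₗ LinearMap.mulLeft k (a ⊗ₜ[k] (1 : Aᵐᵒᵖ)) =
      swapMul k A ∘ₗ LinearMap.mulLeft k ((1 : A) ⊗ₜ[k] op a) := by
    refine TensorProduct.ext' fun b c => ?_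
    simp [mul_assoc]
  exact LinearMap.congr_fun h r

/-- The projection `y ↦ ∑ e_{i+m} y e_i`. -/
def cut (m : ZMod l) : A →ₗ[k] A :=
  ∑ i, LinearMap.mulLeft k (T.e (i + m)) ∘ₗ LinearMap.mulRight k (T.e i)

theorem cut_apply (m : ZMod l) (y : A) : T.cut m y = ∑ i, T.e (i + m) * (y * T.e i) := by
  simp [cut]

theorem swapMul_mul_eps (m : ZMod l) (r : A ⊗[k] Aᵐᵒᵖ) :
    swapMul k A (r * T.eps m) = T.cut m (swapMul k A r) := by
  have h : swapMul k A ∘ₗ LinearMap.mulRight k (T.eps m) = T.cut m ∘ₗ swapMul k A := by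
    refine TensorProduct.ext' fun a b => ?_
    simp [tmul_mul_eps, cut_apply, mul_assoc]
  exact LinearMap.congr_fun h r

/-- The differentials of the commutator quotient of the minimal resolution. -/
def algDiff (p : ℕ) : A →ₗ[k] A :=
  if Even p then LinearMap.mulRight k T.x - LinearMap.mulLeft k T.x
  else ∑ t ∈ Finset.range n,
    LinearMap.mulLeft k (T.x ^ (n - 1 - t)) ∘ₗ LinearMap.mulRight k (T.x ^ t)

theorem swapMul_mul_diffElt (p : ℕ) (r : A ⊗[k] Aᵐᵒᵖ) :
    swapMul k A (r * T.diffElt p) = T.algDiff p (swapMul k A r) := by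
  have h : swapMul k A ∘ₗ LinearMap.mulRight k (T.diffElt p) = T.algDiff p ∘ₗ swapMul k A := by
    refine TensorProduct.ext' fun a b => ?_
    by_cases hp : Even p
    · simp [diffElt, algDiff, hp, mul_sub, z₁, z₂, mul_assoc]
    · simp [diffElt, algDiff, hp, geom, Finset.mul_sum, z₁_pow, z₂_pow, mul_assoc]
  exact LinearMap.congr_fun h r

/-- The commutator quotient of `T.leftIdeal m` as a subspace of the algebra. -/
def cyclePart (m : ZMod l) : Submodule k A := LinearMap.eqLocus (T.cut m) LinearMap.id

theorem mem_cyclePart {m : ZMod l} {y : A} : y ∈ T.cyclePart m ↔ T.cut m y = y := Iff.rfl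

theorem swapMul_mem {m : ZMod l} {r : A ⊗[k] Aᵐᵒᵖ} (hr : r ∈ T.leftIdeal m) :
    swapMul k A r ∈ T.cyclePart m := by
  rw [mem_cyclePart, ← swapMul_mul_eps, hr]

theorem swapMul_tmul_one_mul_eps {m : ZMod l} {y : A} (hy : y ∈ T.cyclePart m) :
    swapMul k A ((y ⊗ₜ[k] 1) * T.eps m) = y := by
  rw [swapMul_mul_eps, swapMul_tmul, unop_one, one_mul, T.mem_cyclePart.1 hy]

theorem algDiff_mem (hn : 1 ≤ n) (p : ℕ) {y : A} (hy : y ∈ T.cyclePart (shift l n (p + 1))) :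
    T.algDiff p y ∈ T.cyclePart (shift l n p) := by
  rw [← T.swapMul_tmul_one_mul_eps hy, ← swapMul_mul_diffElt]
  exact T.swapMul_mem (T.mul_diffElt_mem hn p ⟨_, T.mul_eps_mem _ _⟩)

/-- The differential of the commutator quotient of the minimal resolution. -/
def cycleDiff (hn : 1 ≤ n) (p : ℕ) :
    T.cyclePart (shift l n (p + 1)) →ₗ[k] T.cyclePart (shift l n p) :=
  (T.algDiff p).restrict fun _ hy => T.algDiff_mem hn p hy

/-- Each `y` lifts along `swapMul` to `(y ⊗ 1) * eps`, so the claim descends from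
`diffElt_mul_diffElt`. -/
theorem cycleDiff_cycleDiff (hn : 1 ≤ n) (p : ℕ) (y : T.cyclePart (shift l n (p + 1 + 1))) :
    T.cycleDiff hn p (T.cycleDiff hn (p + 1) y) = 0 := by
  refine Subtype.ext ?_
  change T.algDiff p (T.algDiff (p + 1) y) = 0
  rw [← T.swapMul_tmul_one_mul_eps y.2, ← swapMul_mul_diffElt, ← swapMul_mul_diffElt, mul_assoc,
    mul_assoc, diffElt_mul_diffElt]
  simp

theorem cut_mul_e (m i : ZMod l) (y : A) : T.cut m y * T.e i = T.e (i + m) * (y * T.e i) := by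
  rw [cut_apply, Finset.sum_mul, Finset.sum_eq_single i]
  · simp [mul_assoc, T.e_mul_e]
  · intro j _ hj
    simp [mul_assoc, T.e_mul_e, hj]
  · simp

/-- The section of the commutator quotient of `T.leftIdeal m`. -/
def cycleSec (m : ZMod l) : A →+ T.leftIdeal m :=
  AddMonoidHom.mk' (fun y => ⟨_, T.mul_eps_mem m (y ⊗ₜ[k] 1)⟩) fun y z => Subtype.ext (by
    change ((y + z : A) ⊗ₜ[k] 1) * _ = y ⊗ₜ[k] 1 * _ + z ⊗ₜ[k] 1 * _
    rw [TensorProduct.add_tmul, add_mul])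

theorem coe_cycleSec (m : ZMod l) (y : A) :
    (T.cycleSec m y : A ⊗[k] Aᵐᵒᵖ) = (y ⊗ₜ[k] 1) * T.eps m := rfl

theorem coe_cycleSec_mul_e (m i : ZMod l) (y : A) :
    (T.cycleSec m (y * T.e i) : A ⊗[k] Aᵐᵒᵖ) = (y * T.e i) ⊗ₜ[k] op (T.e (i + m)) := by
  rw [coe_cycleSec, tmul_mul_eps, Finset.sum_eq_single i]
  · simp [mul_assoc, T.e_mul_e]
  · intro j _ hj
    simp [mul_assoc, T.e_mul_e, hj.symm]
  · simp

/-- The terms `a e_i ⊗ e_{i+m} b` and `e_{i+m} b a e_i ⊗ e_{i+m}` arise from `a e_i ⊗ e_{i+m}` by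
the right and the left action of the same element `e_{i+m} b`. -/
theorem tmul_mul_eps_sub_cycleSec (m : ZMod l) (a : A) (b : Aᵐᵒᵖ) :
    (a ⊗ₜ[k] b) * T.eps m - T.cycleSec m (T.cut m (unop b * a)) =
      -∑ i, (((T.e (i + m) * unop b) ⊗ₜ[k] (1 : Aᵐᵒᵖ)) * T.cycleSec m (a * T.e i) -
        ((1 : A) ⊗ₜ[k] op (T.e (i + m) * unop b)) * T.cycleSec m (a * T.e i)) := by
  rw [Finset.sum_sub_distrib, neg_sub, coe_cycleSec, tmul_mul_eps, tmul_mul_eps]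
  congr 1
  · refine Finset.sum_congr rfl fun i _ => ?_
    rw [coe_cycleSec_mul_e]
    simp [← op_mul]
    simp [← mul_assoc, T.e_mul_e]
  · refine Finset.sum_congr rfl fun i _ => ?_
    rw [coe_cycleSec_mul_e, cut_mul_e]
    simp [mul_assoc]

theorem sub_cycleSec_mem (m : ZMod l) (r : T.leftIdeal m) :
    r - T.cycleSec m (swapMul k A r) ∈
      AddSubgroup.closure {y | ∃ (a : A) (m : T.leftIdeal m), y =
        (a ⊗ₜ[k] (1 : Aᵐᵒᵖ) : A ⊗[k] Aᵐᵒᵖ) • m - ((1 : A) ⊗ₜ[k] op a : A ⊗[k] Aᵐᵒᵖ) • m} := by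
  -- `F` extends the identity of the left ideal to all of `Aᵉ`, where pure tensors are available for
  -- induction.
  let F : A ⊗[k] Aᵐᵒᵖ →+ T.leftIdeal m :=
    AddMonoidHom.mk' (fun s => ⟨_, T.mul_eps_mem m s⟩) fun s t => Subtype.ext (add_mul s t _)
  let G : A ⊗[k] Aᵐᵒᵖ →+ T.leftIdeal m :=
    F - ((T.cycleSec m).comp (T.cut m).toAddMonoidHom).comp (swapMul k A).toAddMonoidHom
  have key (s : A ⊗[k] Aᵐᵒᵖ) : G s ∈
      AddSubgroup.closure {y | ∃ (a : A) (m : T.leftIdeal m), y =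
        (a ⊗ₜ[k] (1 : Aᵐᵒᵖ) : A ⊗[k] Aᵐᵒᵖ) • m - ((1 : A) ⊗ₜ[k] op a : A ⊗[k] Aᵐᵒᵖ) • m} := by
    induction s with
    | zero => rw [map_zero]; exact zero_mem _
    | add s t hs ht => rw [map_add]; exact add_mem hs ht
    | tmul a b =>
      have h : G (a ⊗ₜ[k] b) =
          -∑ i, (((T.e (i + m) * unop b) ⊗ₜ[k] (1 : Aᵐᵒᵖ)) • T.cycleSec m (a * T.e i) -
            ((1 : A) ⊗ₜ[k] op (T.e (i + m) * unop b)) • T.cycleSec m (a * T.e i)) := by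
        refine Subtype.ext ?_
        have := T.tmul_mul_eps_sub_cycleSec m a b
        simpa [F, G] using this
      rw [h]
      exact neg_mem (sum_mem fun i _ => AddSubgroup.subset_closure ⟨_, _, rfl⟩)
  have hF : F r = r := Subtype.ext r.2
  have h := key r
  change F r - T.cycleSec m (T.cut m (swapMul k A r)) ∈ _ at h
  rwa [hF, T.mem_cyclePart.1 (T.swapMul_mem r.2)] at h

end Coinvariants

section Homology

variable {k : Type u} {A : Type (max u v)} [Field k] [Ring A] [Algebra k A] {l n : ℕ} [NeZero l]
  (T : TruncatedCycle k A l n)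

/-- The commutator quotient of `T.leftIdeal m`. -/
def leftIdealQuotient (m : ZMod l) : CommutatorQuotient k A (T.leftIdeal m) (T.cyclePart m) where
  proj := (((swapMul k A).toAddMonoidHom.comp
    (T.leftIdeal m).toAddSubgroup.subtype).codRestrict (T.cyclePart m).toAddSubgroup
      fun r => T.swapMul_mem r.2)
  proj_smul c r := Subtype.ext (by
    change swapMul k A (algebraMap k _ c * (r : A ⊗[k] Aᵐᵒᵖ)) = c • swapMul k A r
    rw [← Algebra.smul_def, map_smul])
  proj_comm a r := Subtype.ext (swapMul_comm k a r)
  sec := (T.cycleSec m).comp (T.cyclePart m).subtype.toAddMonoidHom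
  proj_sec y := Subtype.ext (T.swapMul_tmul_one_mul_eps y.2)
  sub_mem := T.sub_cycleSec_mem m

theorem leftIdealQuotient_proj_resDiff (hn : 1 ≤ n) (p : ℕ)
    (r : T.leftIdeal (shift l n (p + 1))) :
    (T.leftIdealQuotient _).proj (T.resDiff hn p r) =
      T.cycleDiff hn p ((T.leftIdealQuotient _).proj r) :=
  Subtype.ext (T.swapMul_mul_diffElt p r)

/-- The Hochschild homology of a truncated cycle algebra is computed by the small complex. -/
theorem nonempty_HH_iso (hn : 1 ≤ n) (p : ℕ) :
    Nonempty (HH k A p ≅ (linComplex (fun p => T.cyclePart (shift l n p)) (T.cycleDiff hn)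
      (T.cycleDiff_cycleDiff hn)).homology p) :=
by
  have h1 := Hochschild.nonempty_HH_iso.{u, v} k A (fun p => T.leftIdeal (shift l n p))
    (fun p => T.projective_leftIdeal _) (T.resDiff hn) (T.resDiff_resDiff hn) (T.resAug _)
    (T.resAug_resDiff hn) T.resAug_surjective (T.resAug_exact hn) (T.resDiff_exact hn)
    (fun p => T.cyclePart (shift l n p)) (T.cycleDiff hn) (T.cycleDiff_cycleDiff hn)
  exact h1 (fun p => T.leftIdealQuotient _) (T.leftIdealQuotient_proj_resDiff hn) p

end Homology

end

end TruncatedCycle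

/-! ### Dimensions of homology over a field -/

section HomologyDimension

universe u w

variable {k : Type u} [Field k]

theorem CategoryTheory.ShortComplex.finite_homology (S : ShortComplex (ModuleCat.{w} k))
    [Module.Finite k S.X₂] : Module.Finite k S.homology := by
  have : Module.Finite k S.cycles :=
    Module.Finite.of_injective S.iCycles.hom ((ModuleCat.mono_iff_injective S.iCycles).1 inferInstance)
  exact Module.Finite.of_surjective S.homologyπ.hom
    ((ModuleCat.epi_iff_surjective S.homologyπ).1 inferInstance)

theorem CategoryTheory.ShortComplex.finrank_homology_add (S : ShortComplex (ModuleCat.{w} k))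
    [Module.Finite k S.X₂] :
    Module.finrank k S.homology + Module.finrank k (LinearMap.range S.f.hom) =
      Module.finrank k (LinearMap.ker S.g.hom) := by
  have h1 : Module.finrank k S.homology =
      Module.finrank k (LinearMap.ker S.g.hom ⧸ LinearMap.range S.moduleCatToCycles) :=
    S.moduleCatHomologyIso.toLinearEquiv.finrank_eq
  have h2 : LinearMap.range S.f.hom =
      (LinearMap.range S.moduleCatToCycles).map (LinearMap.ker S.g.hom).subtype := by
    rw [← LinearMap.range_comp]
    rfl
  rw [h1, h2, Submodule.finrank_map_subtype_eq]
  exact Submodule.finrank_quotient_add_finrank _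

namespace Hochschild

variable (Y : ℕ → Type w) [∀ p, AddCommGroup (Y p)] [∀ p, Module k (Y p)]
  [∀ p, Module.Finite k (Y p)] (b : ∀ p, Y (p + 1) →ₗ[k] Y p)
  (hb : ∀ p x, b p (b (p + 1) x) = 0)

theorem finite_homology_linComplex (p : ℕ) : Module.Finite k ((linComplex Y b hb).homology p) :=
  haveI : Module.Finite k ((linComplex Y b hb).sc p).X₂ := inferInstanceAs (Module.Finite k (Y p))
  ((linComplex Y b hb).sc p).finite_homology

/-- Rank–nullity trades the rank of the incoming differential for its kernel, so only kernels and
terms of the complex have to be measured. -/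
theorem finrank_homology_linComplex_succ (p : ℕ) :
    Module.finrank k ((linComplex Y b hb).homology (p + 1)) +
      Module.finrank k (Y (p + 1 + 1)) =
      Module.finrank k (LinearMap.ker (b p)) + Module.finrank k (LinearMap.ker (b (p + 1))) := by
  let S := (linComplex Y b hb).sc' (p + 2) (p + 1) p
  have e : Module.finrank k ((linComplex Y b hb).homology (p + 1)) =
      Module.finrank k S.homology :=
    ((linComplex Y b hb).homologyIsoSc' (p + 2) (p + 1) p (by simp)
      (by simp)).toLinearEquiv.finrank_eq
  have : Module.Finite k S.X₂ := inferInstanceAs (Module.Finite k (Y (p + 1)))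
  have hf : S.f = ModuleCat.ofHom (b (p + 1)) := linComplex_d Y b hb (p + 1)
  have hg : S.g = ModuleCat.ofHom (b p) := linComplex_d Y b hb p
  have h : Module.finrank k S.homology + Module.finrank k (LinearMap.range (b (p + 1))) =
      Module.finrank k (LinearMap.ker (b p)) := by
    have h := S.finrank_homology_add
    rw [hf, hg] at h
    exact h
  have h' := (b (p + 1)).finrank_range_add_finrank_ker
  rw [e]
  omega

theorem finrank_homology_linComplex_zero :
    Module.finrank k ((linComplex Y b hb).homology 0) + Module.finrank k (Y (0 + 1)) =
      Module.finrank k (Y 0) + Module.finrank k (LinearMap.ker (b 0)) := by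
  let S := (linComplex Y b hb).sc' 1 0 0
  have e : Module.finrank k ((linComplex Y b hb).homology 0) =
      Module.finrank k S.homology :=
    ((linComplex Y b hb).homologyIsoSc' 1 0 0 (by simp) (by simp)).toLinearEquiv.finrank_eq
  have : Module.Finite k S.X₂ := inferInstanceAs (Module.Finite k (Y 0))
  have hf : S.f = ModuleCat.ofHom (b 0) := linComplex_d Y b hb 0
  have hg : S.g = 0 := (linComplex Y b hb).shape 0 0 (by simp)
  have h : Module.finrank k S.homology + Module.finrank k (LinearMap.range (b 0)) =
      Module.finrank k (Y 0) := by
    have h := S.finrank_homology_add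
    rw [hf, hg, ModuleCat.hom_zero, LinearMap.ker_zero, finrank_top] at h
    exact h
  have h' := (b 0).finrank_range_add_finrank_ker
  rw [e]
  omega

end Hochschild

end HomologyDimension

section PiSubmodule

/-- A product of subspaces as a subspace of the product. -/
def Submodule.piEquiv {k ι : Type*} [Field k] {M : ι → Type*} [∀ i, AddCommGroup (M i)]
    [∀ i, Module k (M i)] (U : ∀ i, Submodule k (M i)) :
    Submodule.pi Set.univ U ≃ₗ[k] ∀ i, U i where
  toFun f i := ⟨f.1 i, f.2 i trivial⟩
  map_add' _ _ := rfl
  map_smul' _ _ := rfl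
  invFun f := ⟨fun i => f i, fun i _ => (f i).2⟩

theorem Submodule.finrank_pi {k ι : Type*} [Field k] [Fintype ι] {M : ι → Type*}
    [∀ i, AddCommGroup (M i)] [∀ i, Module k (M i)] [∀ i, Module.Finite k (M i)]
    (U : ∀ i, Submodule k (M i)) :
    Module.finrank k (Submodule.pi Set.univ U) = ∑ i, Module.finrank k (U i) := by
  rw [(Submodule.piEquiv U).finrank_eq, Module.finrank_pi_fintype]

end PiSubmodule

/-! ### Functions on a cycle with vanishing window sums -/

section NormKernel

variable (k : Type*) [Field k] (l n : ℕ)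

/-- The functions on `ZMod l` with vanishing sums over all `n` consecutive elements. -/
def normKer : Submodule k (ZMod l → k) where
  carrier := {f | ∀ i, ∑ t ∈ Finset.range n, f (i + t) = 0}
  add_mem' hf hg i := by simp [Finset.sum_add_distrib, hf i, hg i]
  zero_mem' i := by simp
  smul_mem' c f hf i := by simp [← Finset.mul_sum, hf i]

/-- The functions on `ZMod l` invariant under translation. -/
def constFun : Submodule k (ZMod l → k) where
  carrier := {f | ∀ i, f i = f (i + 1)}
  add_mem' hf hg i := by simp [← hf i, ← hg i]
  zero_mem' i := by simp
  smul_mem' c f hf i := by simp [← hf i]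

theorem constFun_eq_span [NeZero l] : constFun k l = Submodule.span k {fun _ => 1} := by
  apply le_antisymm
  · intro f hf
    have h (a : ℕ) : f a = f 0 := by
      induction a with
      | zero => simp
      | succ a ih => rw [Nat.cast_succ, ← hf, ih]
    refine Submodule.mem_span_singleton.2 ⟨f 0, funext fun i => ?_⟩
    rw [← ZMod.natCast_zmod_val i, h]
    simp
  · rw [Submodule.span_singleton_le_iff_mem]
    intro i
    rfl

theorem finrank_constFun [NeZero l] : Module.finrank k (constFun k l) = 1 := by
  rw [constFun_eq_span]
  exact finrank_span_singleton fun h => one_ne_zero (congrFun h 0)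

variable {k l n}

/-- The windows starting at `i` and `i + 1` differ only in `f i` and `f (i + n)`. -/
theorem apply_add_of_mem_normKer {f : ZMod l → k} (hf : f ∈ normKer k l n) (i : ZMod l) :
    f (i + n) = f i := by
  have h1 := hf (i + 1)
  have h2 := hf i
  have h3 : ∑ t ∈ Finset.range (n + 1), f (i + t) = 0 + f (i + n) := by
    rw [Finset.sum_range_succ, h2]
  rw [Finset.sum_range_succ'] at h3
  have h4 : ∑ t ∈ Finset.range n, f (i + (t + 1 : ℕ)) = 0 := by
    rw [← h1]
    refine Finset.sum_congr rfl fun t _ => ?_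
    congr 1
    push_cast
    ring
  rw [h4] at h3
  simpa using h3.symm

theorem apply_add_gcd_of_mem_normKer [NeZero l] {f : ZMod l → k} (hf : f ∈ normKer k l n) (i : ZMod l) :
    f (i + (n.gcd l : ℕ)) = f i := by
  have h (u : ℕ) : f (i + (n : ZMod l) * u) = f i := by
    induction u with
    | zero => simp
    | succ u ih =>
      rw [← ih, ← apply_add_of_mem_normKer hf (i + (n : ZMod l) * u)]
      congr 1
      push_cast
      ring
  -- Bézout modulo `l`: the multiple of `l` disappears, and the coefficient of `n` is replaced by
  -- its natural representative.
  have h2 : ((n.gcd l : ℕ) : ZMod l) = (n : ZMod l) * ((((n.gcdA l : ℤ) : ZMod l)).val : ℕ) := by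
    rw [ZMod.natCast_zmod_val]
    have := congrArg (fun z : ℤ => (z : ZMod l)) (Nat.gcd_eq_gcd_ab n l)
    simpa using this
  rw [h2, h]

variable (k l n)

/-- Pulling back functions along the projection `ZMod l → ZMod (gcd n l)`. -/
def pullGcd : (ZMod (n.gcd l) → k) →ₗ[k] (ZMod l → k) :=
  LinearMap.funLeft k k (ZMod.castHom (Nat.gcd_dvd_right n l) (ZMod (n.gcd l)))

theorem pullGcd_injective : Function.Injective (pullGcd k l n) :=
  LinearMap.funLeft_injective_of_surjective _ _ _ (ZMod.castHom_surjective _)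

variable [NeZero l]

instance : NeZero (n.gcd l) := ⟨Nat.gcd_ne_zero_right (NeZero.ne l)⟩

/-- The functional `h ↦ (n / gcd n l) ∑ h`. -/
def sumFunctional : (ZMod (n.gcd l) → k) →ₗ[k] k :=
  ((n / n.gcd l : ℕ) : k) • ∑ j, LinearMap.proj j

theorem sumFunctional_apply (h : ZMod (n.gcd l) → k) :
    sumFunctional k l n h = ((n / n.gcd l : ℕ) : k) * ∑ j, h j := by
  simp [sumFunctional]

variable {k} in
theorem sum_range_zmod {g : ℕ} [NeZero g] (h : ZMod g → k) (i : ZMod g) :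
    ∑ t ∈ Finset.range g, h (i + t) = ∑ j, h j := by
  rw [← Equiv.sum_comp (Equiv.addLeft i) h]
  refine Finset.sum_bij' (fun t _ => (t : ZMod g)) (fun j _ => j.val) ?_ ?_ ?_ ?_ ?_
  · simp
  · simp [ZMod.val_lt]
  · intro t ht
    exact ZMod.val_cast_of_lt (Finset.mem_range.1 ht)
  · simp
  · simp

variable {k} in
theorem sum_range_mul_zmod {g : ℕ} [NeZero g] (h : ZMod g → k) (q : ℕ) (i : ZMod g) :
    ∑ t ∈ Finset.range (g * q), h (i + t) = q * ∑ j, h j := by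
  induction q with
  | zero => simp
  | succ q ih =>
    rw [mul_add, mul_one, Finset.sum_range_add, ih]
    simp [sum_range_zmod, add_mul]

variable {k} in
-- A window of length `n` runs `n / gcd n l` times through `ZMod (gcd n l)`, so all windows impose
-- the same single condition.
theorem pullGcd_mem_normKer (h : ZMod (n.gcd l) → k) :
    pullGcd k l n h ∈ normKer k l n ↔ sumFunctional k l n h = 0 := by
  have key (i : ZMod l) : ∑ t ∈ Finset.range n, pullGcd k l n h (i + t) =
      sumFunctional k l n h := by
    rw [sumFunctional_apply]
    rw [← sum_range_mul_zmod h (n / n.gcd l) (ZMod.castHom (Nat.gcd_dvd_right n l) _ i),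
      Nat.mul_div_cancel' (Nat.gcd_dvd_left n l)]
    refine Finset.sum_congr rfl fun t _ => ?_
    simp only [pullGcd, LinearMap.funLeft_apply, map_add, map_natCast]
  constructor
  · intro hh
    rw [← key 0]
    exact hh 0
  · intro hh i
    rw [key, hh]

theorem normKer_eq_map :
    normKer k l n = (LinearMap.ker (sumFunctional k l n)).map (pullGcd k l n) := by
  apply le_antisymm
  · intro f hf
    have hp : pullGcd k l n (fun j => f (j.val : ℕ)) = f := by
      funext i
      change f (((ZMod.castHom (Nat.gcd_dvd_right n l) (ZMod (n.gcd l)) i).val : ℕ)) = f i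
      have h1 : ZMod.castHom (Nat.gcd_dvd_right n l) (ZMod (n.gcd l)) i =
          ((i.val : ℕ) : ZMod (n.gcd l)) := by
        conv_lhs => rw [← ZMod.natCast_zmod_val i]
        rw [map_natCast]
      rw [h1, ZMod.val_natCast]
      conv_rhs => rw [← ZMod.natCast_zmod_val i, ← Nat.mod_add_div i.val (n.gcd l)]
      generalize i.val / n.gcd l = q
      induction q with
      | zero => simp
      | succ q ih =>
        rw [ih, ← apply_add_gcd_of_mem_normKer hf]
        congr 1
        push_cast
        ring
    refine ⟨_, ?_, hp⟩
    rw [SetLike.mem_coe, LinearMap.mem_ker, ← pullGcd_mem_normKer, hp]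
    exact hf
  · rw [Submodule.map_le_iff_le_comap]
    intro h hh
    exact (pullGcd_mem_normKer l n h).2 hh

theorem finrank_normKer_eq :
    Module.finrank k (normKer k l n) = Module.finrank k (LinearMap.ker (sumFunctional k l n)) := by
  rw [normKer_eq_map]
  exact (Submodule.equivMapOfInjective _ (pullGcd_injective k l n) _).finrank_eq.symm

theorem finrank_normKer_of_dvd (h : ringChar k ∣ n / n.gcd l) :
    Module.finrank k (normKer k l n) = n.gcd l := by
  have h0 : sumFunctional k l n = 0 := by
    rw [sumFunctional, (ringChar.spec k _).2 h, zero_smul]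
  rw [finrank_normKer_eq, h0, LinearMap.ker_zero, finrank_top, Module.finrank_fintype_fun_eq_card,
    ZMod.card]

theorem finrank_normKer_of_not_dvd (h : ¬ ringChar k ∣ n / n.gcd l) :
    Module.finrank k (normKer k l n) + 1 = n.gcd l := by
  have h0 : sumFunctional k l n ≠ 0 := by
    intro h1
    -- On the indicator of a point the functional takes the value `n / gcd n l`.
    have h2 := LinearMap.congr_fun h1 (Pi.single 0 1)
    rw [sumFunctional_apply] at h2
    exact h ((ringChar.spec k _).1 (by simpa using h2))
  have h1 := (sumFunctional k l n).finrank_range_add_finrank_ker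
  rw [LinearMap.range_eq_top.2 (LinearMap.surjective h0), finrank_top, Module.finrank_self,
    Module.finrank_fintype_fun_eq_card, ZMod.card] at h1
  rw [finrank_normKer_eq]
  omega

end NormKernel

/-! ### Coefficients and kernels, one path length at a time -/

namespace TruncatedCycle

noncomputable section

section Coefficients

variable {k A : Type*} [Field k] [Ring A] [Algebra k A] {l n : ℕ} [NeZero l]
  (T : TruncatedCycle k A l n)

/-- The coefficient of `e i * x ^ a`, which is `0` for `a ≥ n`. -/
def coef (i : ZMod l) (a : ℕ) : A →ₗ[k] k :=
  if h : a < n then T.basis.coord (i, ⟨a, h⟩) else 0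

theorem coef_of_le (i : ZMod l) {a : ℕ} (h : n ≤ a) (y : A) : T.coef i a y = 0 := by
  simp [coef, not_lt.2 h]

theorem coef_fin (i : ZMod l) (a : Fin n) (y : A) : T.coef i a y = T.basis.repr y (i, a) := by
  simp [coef]

theorem coef_e_mul_x_pow (i j : ZMod l) (a b : ℕ) :
    T.coef i a (T.e j * T.x ^ b) = if a < n ∧ j = i ∧ b = a then 1 else 0 := by
  by_cases ha : a < n
  · by_cases hb : b < n
    · have h : T.e j * T.x ^ b = T.basis (j, ⟨b, hb⟩) := (T.basis_apply j ⟨b, hb⟩).symm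
      rw [coef, dif_pos ha, h, Module.Basis.coord_apply, Module.Basis.repr_self,
        Finsupp.single_apply]
      simp [ha]
    · rw [T.x_pow_eq_zero (not_lt.1 hb), mul_zero, map_zero, if_neg (by omega)]
  · rw [T.coef_of_le _ (not_lt.1 ha), if_neg (by tauto)]

theorem eq_zero_iff_coef (y : A) : y = 0 ↔ ∀ i a, a < n → T.coef i a y = 0 := by
  constructor
  · rintro rfl
    simp
  · intro h
    apply T.basis.ext_elem
    intro ⟨i, a⟩
    rw [← coef_fin, h i a a.isLt, map_zero]
    rfl

/-- The path `e_j x ^ b` runs from `j` to `j + b`. It survives only in the summand with index `j -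
m`, and there exactly when `j + b = j - m`. -/
theorem coef_cut (m i : ZMod l) (a : ℕ) (y : A) :
    T.coef i a (T.cut m y) = if (a : ZMod l) + m = 0 then T.coef i a y else 0 := by
  have h : T.coef i a ∘ₗ T.cut m = if (a : ZMod l) + m = 0 then T.coef i a else 0 := by
    refine T.basis.ext fun ⟨j, b⟩ => ?_
    have hc : T.cut m (T.e j * T.x ^ (b : ℕ)) =
        if ((b : ℕ) : ZMod l) + m = 0 then T.e j * T.x ^ (b : ℕ) else 0 := by
      rw [cut_apply, Finset.sum_eq_single (j - m)]
      · rw [mul_assoc, ← sub_add_cancel (j - m) ((b : ℕ) : ZMod l), ← e_mul_x_pow, sub_add_cancel,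
          ← mul_assoc (T.e j), T.e_mul_e, ← mul_assoc]
        split_ifs with h1 h2 h2
        · rw [sub_add_cancel, T.e_mul_e, if_pos rfl]
        · exact absurd (by linear_combination h1) h2
        · exact absurd (by linear_combination h2) h1
        · simp
      · intro i' _ hi'
        have : i' + m ≠ j := fun h => hi' (by rw [← h, add_sub_cancel_right])
        rw [mul_assoc, ← mul_assoc, T.e_mul_e, if_neg this, zero_mul]
      · simp
    rw [LinearMap.comp_apply, T.basis_apply, hc]
    by_cases hb : (b : ℕ) = a
    · subst hb
      split_ifs <;> simp
    · split_ifs <;> simp [coef_e_mul_x_pow, hb]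
  rw [← LinearMap.comp_apply, h]
  split_ifs <;> rfl

theorem coef_mul (i : ZMod l) (a s t : ℕ) (y : A) :
    T.coef i a (T.x ^ s * (y * T.x ^ t)) =
      if s + t ≤ a ∧ a < n then T.coef (i + s) (a - (s + t)) y else 0 := by
  have h : T.coef i a ∘ₗ LinearMap.mulLeft k (T.x ^ s) ∘ₗ LinearMap.mulRight k (T.x ^ t) =
      if s + t ≤ a ∧ a < n then T.coef (i + s) (a - (s + t)) else 0 := by
    refine T.basis.ext fun ⟨j, b⟩ => ?_
    have hb : T.x ^ s * (T.e j * T.x ^ (b : ℕ) * T.x ^ t) = T.e (j - s) * T.x ^ (s + b + t) := by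
      rw [← sub_add_cancel j (s : ZMod l), mul_assoc, ← mul_assoc (T.x ^ s), ← e_mul_x_pow,
        sub_add_cancel, mul_assoc, ← pow_add, ← pow_add, add_assoc]
    simp only [LinearMap.comp_apply, LinearMap.mulLeft_apply, LinearMap.mulRight_apply,
      T.basis_apply, hb, coef_e_mul_x_pow]
    have := b.isLt
    split_ifs with h1 h2 h2
    · rw [coef_e_mul_x_pow, if_pos]
      exact ⟨by omega, by rw [← h1.2.1]; ring, by omega⟩
    · omega
    · rw [coef_e_mul_x_pow, if_neg]
      rintro ⟨h3, h4, h5⟩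
      exact h1 ⟨h2.2, by rw [h4]; ring, by omega⟩
    · rfl
  have h' := LinearMap.congr_fun h y
  simp only [LinearMap.comp_apply, LinearMap.mulLeft_apply, LinearMap.mulRight_apply] at h'
  rw [h']
  split_ifs <;> rfl

theorem mem_cyclePart_iff (m : ZMod l) (y : A) :
    y ∈ T.cyclePart m ↔ ∀ a : Fin n, (fun i => T.coef i a y) ∈
      (if ((a : ℕ) : ZMod l) + m = 0 then ⊤ else ⊥ : Submodule k (ZMod l → k)) := by
  rw [mem_cyclePart, ← sub_eq_zero, T.eq_zero_iff_coef]
  constructor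
  · intro h a
    split_ifs with ha
    · trivial
    · rw [Submodule.mem_bot]
      funext i
      have := h i a a.isLt
      rwa [map_sub, coef_cut, if_neg ha, zero_sub, neg_eq_zero] at this
  · intro h i a ha
    rw [map_sub, coef_cut, sub_eq_zero]
    have := h ⟨a, ha⟩
    split_ifs with h1
    · rfl
    · rw [if_neg h1, Submodule.mem_bot] at this
      exact (congrFun this i).symm

/-- The coefficient of `y x - x y` at `e_i x ^ (a + 1)` is the difference of those of `y` at `e_i x
^ a` and `e_{i+1} x ^ a`. Length `n - 1` is unconstrained because `x ^ n = 0`. -/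
theorem algDiff_eq_zero_of_even {p : ℕ} (hp : Even p) (y : A) :
    T.algDiff p y = 0 ↔ ∀ a : Fin n, (a : ℕ) + 1 < n → (fun i => T.coef i a y) ∈ constFun k l := by
  have hd : T.algDiff p y = T.x ^ 0 * (y * T.x ^ 1) - T.x ^ 1 * (y * T.x ^ 0) := by
    simp [algDiff, hp]
  rw [hd, T.eq_zero_iff_coef]
  simp only [map_sub, coef_mul]
  constructor
  · intro h a ha i
    have := h i (a + 1) ha
    rw [if_pos ⟨by omega, ha⟩, if_pos ⟨by omega, ha⟩, sub_eq_zero] at this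
    simpa using this
  · intro h i a ha
    rcases a with _ | a
    · simp
    · have := h ⟨a, by omega⟩ ha i
      rw [if_pos ⟨by omega, ha⟩, if_pos ⟨by omega, ha⟩, sub_eq_zero]
      simpa using this

/-- The differential raises length by `n - 1`, so it sees only length `0` and lands in length `n -
1`, with window sums as coefficients. -/
theorem algDiff_eq_zero_of_odd (hn : 1 ≤ n) {p : ℕ} (hp : ¬ Even p) (y : A) :
    T.algDiff p y = 0 ↔ (fun i => T.coef i 0 y) ∈ normKer k l n := by
  have hd : T.algDiff p y = ∑ t ∈ Finset.range n, T.x ^ (n - 1 - t) * (y * T.x ^ t) := by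
    simp [algDiff, hp]
  have hc (i : ZMod l) (a : ℕ) : T.coef i a (T.algDiff p y) =
      if a + 1 = n then ∑ t ∈ Finset.range n, T.coef (i + (t : ℕ)) 0 y else 0 := by
    rw [hd, map_sum]
    split_ifs with ha
    · rw [← Finset.sum_range_reflect]
      refine Finset.sum_congr rfl fun t ht => ?_
      have ht := Finset.mem_range.1 ht
      rw [coef_mul, if_pos ⟨by omega, by omega⟩]
      rw [show n - 1 - (n - 1 - t) = t by omega, show a - (t + (n - 1 - t)) = 0 by omega]
    · refine Finset.sum_eq_zero fun t ht => ?_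
      have ht := Finset.mem_range.1 ht
      rw [coef_mul, if_neg (by omega)]
  rw [T.eq_zero_iff_coef]
  simp only [hc]
  constructor
  · intro h i
    have := h i (n - 1) (by omega)
    rwa [if_pos (by omega)] at this
  · intro h i a ha
    rw [h i, ite_self]

/-- Grouping the basis by length identifies `A` with `n` copies of the functions on `ZMod l`, and
`S` with the product of the `U a`. -/
theorem finrank_of_coef (U : Fin n → Submodule k (ZMod l → k)) (S : Submodule k A)
    (hS : ∀ y, y ∈ S ↔ ∀ a : Fin n, (fun i => T.coef i a y) ∈ U a) :
    Module.finrank k S = ∑ a, Module.finrank k (U a) := by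
  let Φ : A ≃ₗ[k] (Fin n → ZMod l → k) :=
    T.basis.equivFun.trans ((LinearEquiv.funCongrLeft k k (Equiv.prodComm _ _)).trans
      (LinearEquiv.curry k k (Fin n) (ZMod l)))
  have hΦ (y : A) (a : Fin n) : Φ y a = fun i => T.coef i a y := by
    funext i
    rw [coef_fin]
    rfl
  have h : S = (Submodule.pi Set.univ U).comap Φ.toLinearMap := by
    ext y
    rw [hS]
    simp [Submodule.mem_pi, hΦ]
  rw [← Submodule.finrank_pi, h]
  exact (Φ.ofSubmodule' _).finrank_eq

end Coefficients

end

end TruncatedCycle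

/-! ### Counting multiples and the resulting dimensions -/

/-- The sum counts the multiples of `l` in `(M, M + N]`. With `M = [p/2] n` and `N = n - 1` this is
`N_p`. -/
theorem sum_range_dvd_add (l M N : ℕ) :
    (∑ a ∈ Finset.range N, if l ∣ a + 1 + M then 1 else 0) + M / l = (M + N) / l := by
  induction N with
  | zero => simp
  | succ N ih =>
    rw [Finset.sum_range_succ, ← add_assoc M N 1, Nat.succ_div, ← ih,
      show M + N + 1 = N + 1 + M by ring]
    ring

theorem natCast_add_eq_zero_iff {l : ℕ} (a M : ℕ) : (a : ZMod l) + M = 0 ↔ l ∣ a + M := by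
  rw [← Nat.cast_add, ZMod.natCast_eq_zero_iff]

section Sums

variable (l M N : ℕ)

theorem sum_range_dvd_ends_left (x : ℕ) :
    (∑ a ∈ Finset.range (N + 1), if l ∣ a + M then (if a = 0 then x else l) else 0) =
      (if l ∣ M then x else 0) + l * ∑ a ∈ Finset.range N, if l ∣ a + 1 + M then 1 else 0 := by
  rw [Finset.sum_range_succ', Finset.mul_sum, add_comm]
  simp

theorem sum_range_dvd_left :
    (∑ a ∈ Finset.range (N + 1), if l ∣ a + M then l else 0) =
      (if l ∣ M then l else 0) + l * ∑ a ∈ Finset.range N, if l ∣ a + 1 + M then 1 else 0 := by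
  rw [← sum_range_dvd_ends_left]
  simp

theorem sum_range_dvd_right :
    (∑ a ∈ Finset.range (N + 1), if l ∣ a + (M + 1) then l else 0) =
      l * (∑ a ∈ Finset.range N, if l ∣ a + 1 + M then 1 else 0) +
        if l ∣ M + N + 1 then l else 0 := by
  rw [Finset.sum_range_succ, Finset.mul_sum, show N + (M + 1) = M + N + 1 by ring]
  simp [add_assoc, add_comm 1 M]

theorem sum_range_dvd_ends_right :
    (∑ a ∈ Finset.range (N + 1), if l ∣ a + (M + 1) then (if a + 1 < N + 1 then 1 else l) else 0) =
      (∑ a ∈ Finset.range N, if l ∣ a + 1 + M then 1 else 0) +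
        if l ∣ M + N + 1 then l else 0 := by
  rw [Finset.sum_range_succ, show N + (M + 1) = M + N + 1 by ring, if_neg (lt_irrefl (N + 1))]
  congr 1
  refine Finset.sum_congr rfl fun a ha => ?_
  rw [if_pos (Nat.succ_lt_succ (Finset.mem_range.1 ha)), show a + (M + 1) = a + 1 + M by ring]

end Sums

namespace TruncatedCycle

noncomputable section

open Hochschild

universe u v

section Dimensions

variable {k A : Type*} [Field k] [Ring A] [Algebra k A] {l n : ℕ} [NeZero l]
  (T : TruncatedCycle k A l n)

theorem finrank_cyclePart (M : ℕ) :
    Module.finrank k (T.cyclePart (M : ZMod l)) =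
      ∑ a ∈ Finset.range n, if l ∣ a + M then l else 0 := by
  rw [T.finrank_of_coef _ _ (T.mem_cyclePart_iff _), ← Fin.sum_univ_eq_sum_range]
  refine Finset.sum_congr rfl fun a _ => ?_
  by_cases h : l ∣ a + M
  · rw [if_pos h, if_pos ((natCast_add_eq_zero_iff _ _).2 h)]
    simp
  · rw [if_neg h, if_neg (mt (natCast_add_eq_zero_iff _ _).1 h)]
    simp

theorem finrank_ker_cycleDiff (hn : 1 ≤ n) (p : ℕ) :
    Module.finrank k (LinearMap.ker (T.cycleDiff hn p)) =
      Module.finrank k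
        (T.cyclePart (shift l n (p + 1)) ⊓ LinearMap.ker (T.algDiff p) : Submodule k A) := by
  have h : (LinearMap.ker (T.cycleDiff hn p)).map (T.cyclePart (shift l n (p + 1))).subtype =
      T.cyclePart (shift l n (p + 1)) ⊓ LinearMap.ker (T.algDiff p) := by
    ext y
    constructor
    · rintro ⟨y, hy, rfl⟩
      exact ⟨y.2, congrArg Subtype.val hy⟩
    · rintro ⟨h1, h2⟩
      exact ⟨⟨y, h1⟩, Subtype.ext h2, rfl⟩
  rw [← h, Submodule.finrank_map_subtype_eq]

theorem finrank_ker_of_even (hn : 1 ≤ n) {p : ℕ} (hp : Even p) (M : ℕ)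
    (hM : shift l n (p + 1) = M) :
    Module.finrank k (LinearMap.ker (T.cycleDiff hn p)) =
      ∑ a ∈ Finset.range n, if l ∣ a + M then (if a + 1 < n then 1 else l) else 0 := by
  rw [finrank_ker_cycleDiff, T.finrank_of_coef (fun a => if ((a : ℕ) : ZMod l) + M = 0 then
    (if (a : ℕ) + 1 < n then constFun k l else ⊤) else ⊥), ← Fin.sum_univ_eq_sum_range]
  · refine Finset.sum_congr rfl fun a _ => ?_
    by_cases h : l ∣ a + M
    · rw [if_pos h, if_pos ((natCast_add_eq_zero_iff _ _).2 h)]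
      by_cases h1 : (a : ℕ) + 1 < n
      · rw [if_pos h1, if_pos h1, finrank_constFun]
      · rw [if_neg h1, if_neg h1]
        simp
    · rw [if_neg h, if_neg (mt (natCast_add_eq_zero_iff _ _).1 h)]
      simp
  · intro y
    rw [Submodule.mem_inf, mem_cyclePart_iff, LinearMap.mem_ker, T.algDiff_eq_zero_of_even hp,
      ← forall_and, hM]
    refine forall_congr' fun a => ?_
    split_ifs with h1 h2
    · simp [h2]
    · simp [h2]
    · constructor
      · exact fun h => h.1
      · intro h
        refine ⟨h, fun _ => ?_⟩
        rw [(Submodule.mem_bot k).1 h]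
        exact zero_mem _

theorem finrank_ker_of_odd (hn : 1 ≤ n) {p : ℕ} (hp : ¬ Even p) (M : ℕ)
    (hM : shift l n (p + 1) = M) :
    Module.finrank k (LinearMap.ker (T.cycleDiff hn p)) =
      ∑ a ∈ Finset.range n,
        if l ∣ a + M then (if a = 0 then Module.finrank k (normKer k l n) else l) else 0 := by
  rw [finrank_ker_cycleDiff, T.finrank_of_coef (fun a => if ((a : ℕ) : ZMod l) + M = 0 then
    (if (a : ℕ) = 0 then normKer k l n else ⊤) else ⊥), ← Fin.sum_univ_eq_sum_range]
  · refine Finset.sum_congr rfl fun a _ => ?_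
    by_cases h : l ∣ a + M
    · rw [if_pos h, if_pos ((natCast_add_eq_zero_iff _ _).2 h)]
      by_cases h1 : (a : ℕ) = 0
      · rw [if_pos h1, if_pos h1]
      · rw [if_neg h1, if_neg h1]
        simp
    · rw [if_neg h, if_neg (mt (natCast_add_eq_zero_iff _ _).1 h)]
      simp
  · intro y
    rw [Submodule.mem_inf, mem_cyclePart_iff, LinearMap.mem_ker, T.algDiff_eq_zero_of_odd hn hp, hM]
    constructor
    · rintro ⟨h1, h2⟩ a
      have := h1 a
      split_ifs with h3 h4
      · rwa [h4]
      · trivial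
      · rwa [if_neg h3] at this
    · intro h
      refine ⟨fun a => ?_, ?_⟩
      · have := h a
        split_ifs with h3
        · trivial
        · rwa [if_neg h3] at this
      · have := h ⟨0, hn⟩
        split_ifs at this with h3
        · exact this
        · simp at *
        -- If `l` does not divide `M`, the length `0` coefficients vanish, so the window sums vanish
        -- trivially.
        · rw [Submodule.mem_bot] at this
          rw [this]
          exact zero_mem _

end Dimensions

section Homology

variable {k : Type u} {A : Type (max u v)} [Field k] [Ring A] [Algebra k A] {l n : ℕ} [NeZero l]

theorem finite (T : TruncatedCycle k A l n) : Module.Finite k A := Module.Finite.of_basis T.basis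

theorem finite_HH (T : TruncatedCycle k A l n) (hn : 1 ≤ n) (p : ℕ) :
    Module.Finite k (HH k A p) := by
  have := T.finite
  obtain ⟨e⟩ := T.nonempty_HH_iso hn p
  have := finite_homology_linComplex (fun p => T.cyclePart (shift l n p)) (T.cycleDiff hn)
    (T.cycleDiff_cycleDiff hn) p
  exact Module.Finite.equiv e.toLinearEquiv.symm

theorem hh_zero (T : TruncatedCycle k A l n) (hn : 1 ≤ n) : hh k A 0 = l + (n - 1) / l := by
  have := T.finite
  obtain ⟨e⟩ := T.nonempty_HH_iso hn 0
  have h := finrank_homology_linComplex_zero (fun p => T.cyclePart (shift l n p)) (T.cycleDiff hn)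
    (T.cycleDiff_cycleDiff hn)
  rw [← e.toLinearEquiv.finrank_eq] at h
  -- Writing `n = N + 1` lets the exceptional lengths `0` and `N` be split off the sums.
  obtain ⟨N, rfl⟩ : ∃ N, n = N + 1 := ⟨n - 1, by omega⟩
  have h0 : shift l (N + 1) 0 = ((0 : ℕ) : ZMod l) := by simp [shift]
  have h1 : shift l (N + 1) (0 + 1) = ((0 + 1 : ℕ) : ZMod l) := by simp [shift]
  have hS := sum_range_dvd_add l 0 N
  rw [T.finrank_ker_of_even hn (by simp) (0 + 1) h1, h0, h1, finrank_cyclePart, finrank_cyclePart,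
    sum_range_dvd_left l 0, sum_range_dvd_right l 0, sum_range_dvd_ends_right,
    if_pos (dvd_zero l)] at h
  simp only [Nat.zero_div, zero_add, add_zero, Nat.add_sub_cancel] at *
  rw [hS] at h
  change hh k A 0 + _ = _ at h
  generalize l * (N / l) = x at h
  omega

/-- The extra term is the length `0` part of the kernel in degree `2c`. The length `n - 1` part of
the next kernel cancels against the same part of degree `2c + 1`. -/
theorem hh_even (T : TruncatedCycle k A l n) (hn : 1 ≤ n) (c : ℕ) (hc : 1 ≤ c) :
    hh k A (2 * c) + c * n / l = (c * n + (n - 1)) / l +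
      if l ∣ c * n then Module.finrank k (normKer k l n) else 0 := by
  have := T.finite
  obtain ⟨d, rfl⟩ : ∃ d, c = d + 1 := ⟨c - 1, by omega⟩
  obtain ⟨e⟩ := T.nonempty_HH_iso hn (2 * d + 1 + 1)
  have h := finrank_homology_linComplex_succ (fun p => T.cyclePart (shift l n p)) (T.cycleDiff hn)
    (T.cycleDiff_cycleDiff hn) (2 * d + 1)
  rw [← e.toLinearEquiv.finrank_eq] at h
  obtain ⟨N, rfl⟩ : ∃ N, n = N + 1 := ⟨n - 1, by omega⟩
  have h0 : shift l (N + 1) (2 * d + 1 + 1) = (((d + 1) * (N + 1) : ℕ) : ZMod l) := by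
    rw [shift, show (2 * d + 1 + 1) / 2 = d + 1 by omega, show (2 * d + 1 + 1) % 2 = 0 by omega,
      add_zero]
  have h1 : shift l (N + 1) (2 * d + 1 + 1 + 1) = (((d + 1) * (N + 1) + 1 : ℕ) : ZMod l) := by
    rw [shift, show (2 * d + 1 + 1 + 1) / 2 = d + 1 by omega,
      show (2 * d + 1 + 1 + 1) % 2 = 1 by omega]
  have hS := sum_range_dvd_add l ((d + 1) * (N + 1)) N
  rw [T.finrank_ker_of_even hn (by simp [parity_simps]) _ h1,
    T.finrank_ker_of_odd hn (by simp [parity_simps]) _ h0, h1, finrank_cyclePart,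
    sum_range_dvd_ends_left, sum_range_dvd_right, sum_range_dvd_ends_right] at h
  change hh k A (2 * (d + 1)) + _ = _ at h
  rw [Nat.add_sub_cancel, ← hS]
  -- The product of `l` with the count occurs equally on both sides; naming it leaves a linear
  -- identity.
  generalize l * _ = x at h
  omega

/-- Length `n - 1` in degree `2c + 1` and length `0` in degree `2c + 2` are governed by the same
condition `l ∣ (c + 1) n`. Their contributions `l` cancel, leaving the window-sum kernel. -/
theorem hh_odd (T : TruncatedCycle k A l n) (hn : 1 ≤ n) (c : ℕ) :
    hh k A (2 * c + 1) + c * n / l = (c * n + (n - 1)) / l +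
      if l ∣ (c + 1) * n then Module.finrank k (normKer k l n) else 0 := by
  have := T.finite
  obtain ⟨e⟩ := T.nonempty_HH_iso hn (2 * c + 1)
  have h := finrank_homology_linComplex_succ (fun p => T.cyclePart (shift l n p)) (T.cycleDiff hn)
    (T.cycleDiff_cycleDiff hn) (2 * c)
  rw [← e.toLinearEquiv.finrank_eq] at h
  obtain ⟨N, rfl⟩ : ∃ N, n = N + 1 := ⟨n - 1, by omega⟩
  have h0 : shift l (N + 1) (2 * c + 1) = ((c * (N + 1) + 1 : ℕ) : ZMod l) := by
    rw [shift, show (2 * c + 1) / 2 = c by omega, show (2 * c + 1) % 2 = 1 by omega]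
  have h1 : shift l (N + 1) (2 * c + 1 + 1) = ((c * (N + 1) + N + 1 : ℕ) : ZMod l) := by
    rw [shift, show (2 * c + 1 + 1) / 2 = c + 1 by omega, show (2 * c + 1 + 1) % 2 = 0 by omega]
    congr 1
    ring
  have hS := sum_range_dvd_add l (c * (N + 1)) N
  rw [T.finrank_ker_of_even hn (by simp) _ h0,
    T.finrank_ker_of_odd hn (by simp [parity_simps]) _ h1, h1, finrank_cyclePart,
    sum_range_dvd_ends_left, sum_range_dvd_left, sum_range_dvd_ends_right] at h
  change hh k A (2 * c + 1) + _ = _ at h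
  rw [Nat.add_sub_cancel, ← hS, show (c + 1) * (N + 1) = c * (N + 1) + N + 1 by ring]
  generalize l * _ = x at h
  omega

end Homology

end

end TruncatedCycle

/-! ### The path algebra of a basic cycle and its truncation -/

namespace PathAlgebra

noncomputable section

section Length

variable (k : Type*) {V : Type*} [Field k] [Quiver V]

theorem ofPath_mul_ofPath [Fintype V] (p q : QuiverPath V) :
    ofPath k p * ofPath k q = mulPath k p q :=
  mulLin_ofPath k p q

/-- The coefficient of a path. -/
def coeff (p : QuiverPath V) : PathAlgebra k V →ₗ[k] k := Finsupp.lapply p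

theorem coeff_ofPath_self (p : QuiverPath V) : coeff k p (ofPath k p) = 1 :=
  Finsupp.single_eq_same

theorem coeff_ofPath_of_ne {p q : QuiverPath V} (h : q ≠ p) : coeff k p (ofPath k q) = 0 :=
  Finsupp.single_eq_of_ne' h

variable (V) in
/-- The span of all paths of length at least `n`. -/
def longPaths (n : ℕ) : Submodule k (PathAlgebra k V) :=
  Submodule.span k {x | ∃ p : QuiverPath V, n ≤ p.2.2.length ∧ x = ofPath k p}

theorem mulPath_mem_longPaths {n : ℕ} (p q : QuiverPath V)
    (h : n ≤ p.2.2.length + q.2.2.length) : mulPath k p q ∈ longPaths k V n := by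
  obtain ⟨a, b, p⟩ := p
  obtain ⟨c, d, q⟩ := q
  rw [mulPath]
  split_ifs with hbc
  · change b = c at hbc
    subst hbc
    exact Submodule.subset_span ⟨_, by simpa using h, rfl⟩
  · exact zero_mem _

variable [Fintype V]

theorem mul_mem_longPaths {n : ℕ} (x : PathAlgebra k V) {y : PathAlgebra k V}
    (hy : y ∈ longPaths k V n) : x * y ∈ longPaths k V n := by
  induction x using PathAlgebra.induction with
  | h0 => rw [zero_mul]; exact zero_mem _
  | hadd x x' hx hx' => rw [add_mul]; exact add_mem hx hx'
  | hsmul c p =>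
    rw [smul_mul_assoc]
    refine Submodule.smul_mem _ _ ?_
    induction hy using Submodule.span_induction with
    | mem y hy =>
      obtain ⟨q, hq, rfl⟩ := hy
      rw [ofPath_mul_ofPath]
      exact mulPath_mem_longPaths k p q (by omega)
    | zero => rw [mul_zero]; exact zero_mem _
    | add y y' _ _ hy hy' => rw [mul_add]; exact add_mem hy hy'
    | smul c y _ hy => rw [mul_smul_comm]; exact Submodule.smul_mem _ _ hy

theorem mem_longPaths_mul {n : ℕ} (x : PathAlgebra k V) {y : PathAlgebra k V}
    (hy : y ∈ longPaths k V n) : y * x ∈ longPaths k V n := by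
  induction x using PathAlgebra.induction with
  | h0 => rw [mul_zero]; exact zero_mem _
  | hadd x x' hx hx' => rw [mul_add]; exact add_mem hx hx'
  | hsmul c p =>
    rw [mul_smul_comm]
    refine Submodule.smul_mem _ _ ?_
    induction hy using Submodule.span_induction with
    | mem y hy =>
      obtain ⟨q, hq, rfl⟩ := hy
      rw [ofPath_mul_ofPath]
      exact mulPath_mem_longPaths k q p (by omega)
    | zero => rw [zero_mul]; exact zero_mem _
    | add y y' _ _ hy hy' => rw [add_mul]; exact add_mem hy hy'
    | smul c y _ hy => rw [smul_mul_assoc]; exact Submodule.smul_mem _ _ hy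

/-- Multiplying never shortens paths, so the linear span of the long paths is already a two-sided
ideal. Hence short paths stay independent in the quotient. -/
theorem mem_longPaths_of_mem_truncationIdeal {n : ℕ} {x : PathAlgebra k V}
    (hx : x ∈ truncationIdeal k V n) : x ∈ longPaths k V n := by
  let J : TwoSidedIdeal (PathAlgebra k V) := TwoSidedIdeal.mk' (longPaths k V n) (zero_mem _)
    add_mem neg_mem (mul_mem_longPaths k _) (mem_longPaths_mul k _)
  have hJ : truncationIdeal k V n ≤ J := TwoSidedIdeal.span_le.2 fun y hy => by
    rw [SetLike.mem_coe, TwoSidedIdeal.mem_mk']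
    exact Submodule.subset_span hy
  have h := hJ hx
  rwa [TwoSidedIdeal.mem_mk'] at h

theorem coeff_eq_zero_of_mem_truncationIdeal {n : ℕ} {x : PathAlgebra k V}
    (hx : x ∈ truncationIdeal k V n) (p : QuiverPath V) (hp : p.2.2.length < n) :
    coeff k p x = 0 := by
  have h : longPaths k V n ≤ LinearMap.ker (coeff k p) := Submodule.span_le.2 (by
    rintro _ ⟨q, hq, rfl⟩
    exact coeff_ofPath_of_ne k fun h => by subst h; omega)
  exact h (mem_longPaths_of_mem_truncationIdeal k hx)

end Length

section Cycle

theorem exists_path {V : Type*} [Quiver V] {l : ℕ} {v : ZMod l → V}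
    (a : ∀ i, v i ⟶ v (i + 1)) (hs : Function.Surjective v) (x : V) (d : ℕ) :
    ∃ (y : V) (p : Quiver.Path x y), p.length = d := by
  induction d with
  | zero => exact ⟨x, Quiver.Path.nil, rfl⟩
  | succ d ih =>
    obtain ⟨y, p, hp⟩ := ih
    obtain ⟨j, rfl⟩ := hs y
    exact ⟨_, p.cons (a j), by simp [hp]⟩

variable (k : Type*) {V : Type*} [Field k] [Quiver V] [Fintype V] {l : ℕ}
  (v : ZMod l → V) (a : ∀ i, v i ⟶ v (i + 1))

/-- The idempotent of a vertex of the cycle. -/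
def vertex (i : ZMod l) : PathAlgebra k V := ofPath k ⟨v i, v i, Quiver.Path.nil⟩

/-- The arrow starting at a vertex of the cycle. -/
def arrow (i : ZMod l) : PathAlgebra k V := ofPath k ⟨v i, v (i + 1), (a i).toPath⟩

/-- The sum of the arrows of the cycle. -/
def arrowSum [NeZero l] : PathAlgebra k V := ∑ i, arrow k v a i

variable {v}

theorem ofPath_mul_vertex (hv : Function.Injective v) (x : V) (i j : ZMod l) (p : Quiver.Path x (v i)) :
    ofPath k ⟨x, v i, p⟩ * vertex k v j = if i = j then ofPath k ⟨x, v i, p⟩ else 0 := by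
  rw [vertex, ofPath_mul_ofPath, mulPath]
  by_cases h : i = j
  · subst h
    simp
  · simp [h, hv.eq_iff]

theorem vertex_mul_ofPath (hv : Function.Injective v) (y : V) (i j : ZMod l) (p : Quiver.Path (v i) y) :
    vertex k v j * ofPath k ⟨v i, y, p⟩ = if j = i then ofPath k ⟨v i, y, p⟩ else 0 := by
  rw [vertex, ofPath_mul_ofPath, mulPath]
  by_cases h : j = i
  · subst h
    simp
  · simp [h, hv.eq_iff]

theorem vertex_mul_vertex (hv : Function.Injective v) (i j : ZMod l) :
    vertex k v i * vertex k v j = if i = j then vertex k v i else 0 :=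
  ofPath_mul_vertex k hv _ i j _

variable [NeZero l]

theorem vertex_mul_arrowSum (hv : Function.Injective v) (i : ZMod l) :
    vertex k v i * arrowSum k v a = arrow k v a i := by
  rw [arrowSum, Finset.mul_sum, Finset.sum_eq_single i]
  · rw [arrow, vertex_mul_ofPath k hv, if_pos rfl]
  · intro j _ hj
    rw [arrow, vertex_mul_ofPath k hv, if_neg hj.symm]
  · simp

theorem arrowSum_mul_vertex (hv : Function.Injective v) (i : ZMod l) :
    arrowSum k v a * vertex k v (i + 1) = arrow k v a i := by
  rw [arrowSum, Finset.sum_mul, Finset.sum_eq_single i]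
  · rw [arrow, ofPath_mul_vertex k hv, if_pos rfl]
  · intro j _ hj
    rw [arrow, ofPath_mul_vertex k hv, if_neg fun h => hj (add_right_cancel h)]
  · simp

/-- Exactly one arrow leaves each vertex, so a path is determined by its start and its length. -/
theorem ofPath_eq (hv : Function.Injective v)
    (ha : ∀ (x y : V) (f : x ⟶ y), ∃ i,
      (⟨x, y, f⟩ : Σ x y : V, x ⟶ y) = ⟨v i, v (i + 1), a i⟩) (i : ZMod l) {y : V}
    (p : Quiver.Path (v i) y) :
    ofPath k ⟨v i, y, p⟩ = vertex k v i * arrowSum k v a ^ p.length := by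
  induction p with
  | nil => simp [vertex]
  | @cons b c p f ih =>
    obtain ⟨j, hj⟩ := ha b c f
    cases hj
    rw [Quiver.Path.length_cons, pow_succ, ← mul_assoc, ← ih]
    -- The idempotent at the end of `p` is inserted in order to select the single arrow `a j` from
    -- the arrow sum.
    have h := ofPath_mul_vertex k hv _ j j p
    rw [if_pos rfl] at h
    rw [← h, mul_assoc, vertex_mul_arrowSum k a hv, arrow, ofPath_mul_ofPath, mulPath]
    simp

theorem sum_vertex (hb : Function.Bijective v) : ∑ i, vertex k v i = 1 := by
  rw [one_def, ← (Equiv.ofBijective v hb).sum_comp]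
  rfl

end Cycle

end

end PathAlgebra

namespace PathAlgebra

noncomputable section

variable (k : Type*) {V : Type*} [Field k] [Quiver V] [Fintype V]

variable (V) in
/-- The projection of the path algebra to the truncated quiver algebra. -/
def toTruncated (n : ℕ) : PathAlgebra k V →ₐ[k] TruncatedQuiverAlgebra k V n :=
  (truncationIdeal k V n).ringCon.mkₐ k

theorem toTruncated_surjective (n : ℕ) : Function.Surjective (toTruncated k V n) :=
  RingCon.mkₐ_surjective _

theorem toTruncated_eq_zero_iff {n : ℕ} {x : PathAlgebra k V} :
    toTruncated k V n x = 0 ↔ x ∈ truncationIdeal k V n := by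
  rw [TwoSidedIdeal.mem_iff, ← RingCon.eq]
  rfl

theorem toTruncated_ofPath_eq_zero {n : ℕ} (p : QuiverPath V) (hp : n ≤ p.2.2.length) :
    toTruncated k V n (ofPath k p) = 0 :=
  (toTruncated_eq_zero_iff k).2 (TwoSidedIdeal.subset_span ⟨p, hp, rfl⟩)

variable {l : ℕ} [NeZero l] {v : ZMod l → V} (a : ∀ i, v i ⟶ v (i + 1))

theorem toTruncated_vertex_mul_arrowSum_pow (hv : Function.Bijective v)
    (ha : ∀ (x y : V) (f : x ⟶ y), ∃ i,
      (⟨x, y, f⟩ : Σ x y : V, x ⟶ y) = ⟨v i, v (i + 1), a i⟩)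
    {n d : ℕ} (hd : n ≤ d) (i : ZMod l) :
    toTruncated k V n (vertex k v i * arrowSum k v a ^ d) = 0 := by
  obtain ⟨y, p, rfl⟩ := exists_path a hv.2 (v i) d
  rw [← ofPath_eq k a hv.1 ha]
  exact toTruncated_ofPath_eq_zero k _ hd

theorem linearIndependent_truncated (hv : Function.Bijective v)
    (ha : ∀ (x y : V) (f : x ⟶ y), ∃ i,
      (⟨x, y, f⟩ : Σ x y : V, x ⟶ y) = ⟨v i, v (i + 1), a i⟩) (n : ℕ) :
    LinearIndependent k fun s : ZMod l × Fin n =>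
      toTruncated k V n (vertex k v s.1 * arrowSum k v a ^ (s.2 : ℕ)) := by
  choose y p hp using fun s : ZMod l × Fin n => exists_path a hv.2 (v s.1) s.2
  have hop (s : ZMod l × Fin n) :
      vertex k v s.1 * arrowSum k v a ^ (s.2 : ℕ) = ofPath k ⟨v s.1, y s, p s⟩ := by
    rw [ofPath_eq k a hv.1 ha, hp]
  have hne {s t : ZMod l × Fin n} (h : s ≠ t) :
      (⟨v s.1, y s, p s⟩ : QuiverPath V) ≠ ⟨v t.1, y t, p t⟩ := fun he => by
    have h1 : v s.1 = v t.1 := congrArg (fun q : QuiverPath V => q.1) he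
    have h2 : (p s).length = (p t).length := congrArg (fun q : QuiverPath V => q.2.2.length) he
    rw [hp, hp] at h2
    exact h (Prod.ext (hv.1 h1) (Fin.ext h2))
  rw [Fintype.linearIndependent_iff]
  intro g hg t
  simp only [hop, ← map_smul, ← map_sum] at hg
  -- A relation in the quotient lifts to an element of the ideal, whose coefficient at the `t`-th
  -- path, of length less than `n`, is `g t`.
  have h := coeff_eq_zero_of_mem_truncationIdeal k ((toTruncated_eq_zero_iff k).1 hg)
    ⟨v t.1, y t, p t⟩ ((hp t).trans_lt t.2.isLt)
  rw [map_sum, Finset.sum_eq_single t] at h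
  · simpa [coeff_ofPath_self] using h
  · intro s _ hs
    rw [map_smul, coeff_ofPath_of_ne k (hne hs), smul_zero]
  · simp

theorem span_truncated (hv : Function.Bijective v)
    (ha : ∀ (x y : V) (f : x ⟶ y), ∃ i,
      (⟨x, y, f⟩ : Σ x y : V, x ⟶ y) = ⟨v i, v (i + 1), a i⟩) (n : ℕ) :
    ⊤ ≤ Submodule.span k (Set.range fun s : ZMod l × Fin n =>
      toTruncated k V n (vertex k v s.1 * arrowSum k v a ^ (s.2 : ℕ))) := by
  rintro z -
  obtain ⟨x, rfl⟩ := toTruncated_surjective k n z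
  induction x using PathAlgebra.induction with
  | h0 => rw [map_zero]; exact zero_mem _
  | hadd x x' hx hx' => rw [map_add]; exact add_mem hx hx'
  | hsmul c q =>
    rw [map_smul]
    refine Submodule.smul_mem _ _ ?_
    by_cases hq : n ≤ q.2.2.length
    · rw [toTruncated_ofPath_eq_zero k q hq]
      exact zero_mem _
    · obtain ⟨x, y, q⟩ := q
      obtain ⟨i, rfl⟩ := hv.2 x
      rw [ofPath_eq k a hv.1 ha]
      exact Submodule.subset_span ⟨(i, ⟨q.length, not_le.1 hq⟩), rfl⟩

/-- The truncated quiver algebra of a basic cycle as a truncated cycle algebra. -/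
def truncatedCycle (hv : Function.Bijective v)
    (ha : ∀ (x y : V) (f : x ⟶ y), ∃ i,
      (⟨x, y, f⟩ : Σ x y : V, x ⟶ y) = ⟨v i, v (i + 1), a i⟩) (n : ℕ) :
    TruncatedCycle k (TruncatedQuiverAlgebra k V n) l n where
  e i := toTruncated k V n (vertex k v i)
  x := toTruncated k V n (arrowSum k v a)
  basis := Module.Basis.mk (linearIndependent_truncated k a hv ha n) (span_truncated k a hv ha n)
  basis_apply i d := by rw [Module.Basis.mk_apply, map_mul, map_pow]
  e_mul_e i j := by
    rw [← map_mul, vertex_mul_vertex k hv.1]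
    split_ifs
    · rfl
    · exact map_zero _
  sum_e := by rw [← map_sum, sum_vertex k hv, map_one]
  e_mul_x i := by
    rw [← map_mul, ← map_mul, vertex_mul_arrowSum k a hv.1, arrowSum_mul_vertex k a hv.1]
  x_pow := by
    -- Splitting `1` into vertices writes `x ^ n` as a sum of classes of paths of length `n`.
    rw [← map_pow, ← one_mul (arrowSum k v a ^ n), ← sum_vertex k hv, Finset.sum_mul, map_sum]
    exact Finset.sum_eq_zero fun i _ =>
      toTruncated_vertex_mul_arrowSum_pow k a hv ha le_rfl i

end

end PathAlgebra

/-! ### Rational floors and assembly of the formula -/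

theorem Rat.floor_natCast_add_sub_one_div (a n l : ℕ) (hn : 1 ≤ n) :
    ⌊((a : ℚ) + n - 1) / l⌋ = ((a + (n - 1)) / l : ℕ) := by
  rw [Int.natCast_div, ← Rat.floor_natCast_div_natCast]
  push_cast [Nat.cast_sub hn]
  rw [add_sub_assoc]

theorem Rat.floor_natCast_div_two (p : ℕ) : ⌊(p : ℚ) / 2⌋ = (p / 2 : ℕ) := by
  exact_mod_cast Rat.floor_natCast_div_natCast p 2

section

universe u v w

theorem TruncatedCycle.hh_of_pos {k : Type u} {A : Type (max u v)} [Field k] [Ring A] [Algebra k A]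
    {l n : ℕ} [NeZero l] (T : TruncatedCycle k A l n) (hn : 1 ≤ n) {p : ℕ} (hp : 1 ≤ p) :
    hh k A p + p / 2 * n / l = (p / 2 * n + (n - 1)) / l +
      if l ∣ (p + 1) / 2 * n then Module.finrank k (normKer k l n) else 0 := by
  obtain ⟨c, rfl | rfl⟩ := Nat.even_or_odd' p
  · rw [show 2 * c / 2 = c by omega, show (2 * c + 1) / 2 = c by omega]
    exact T.hh_even hn c (by omega)
  · rw [show (2 * c + 1) / 2 = c by omega, show (2 * c + 1 + 1) / 2 = c + 1 by omega]
    exact T.hh_odd hn c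

theorem IsBasicCycle.hh_truncatedQuiverAlgebra (k : Type u) [Field k] {V : Type v} [Quiver.{w} V]
    [Fintype V] {l n : ℕ} (hn : 1 ≤ n) (hQ : IsBasicCycle V l) :
    (∀ p : ℕ, Module.Finite k (HH k (TruncatedQuiverAlgebra k V n) p)) ∧
    hh k (TruncatedQuiverAlgebra k V n) 0 = l + (n - 1) / l ∧
    ∀ p : ℕ, 1 ≤ p → hh k (TruncatedQuiverAlgebra k V n) p + p / 2 * n / l =
      (p / 2 * n + (n - 1)) / l +
        if l ∣ (p + 1) / 2 * n then Module.finrank k (normKer k l n) else 0 := by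
  obtain ⟨hl, v, a, hv, ha⟩ := hQ
  have : NeZero l := ⟨by omega⟩
  let T := PathAlgebra.truncatedCycle k a hv ha n
  exact ⟨TruncatedCycle.finite_HH.{u, max v w} T hn, TruncatedCycle.hh_zero.{u, max v w} T hn,
    fun _ => TruncatedCycle.hh_of_pos.{u, max v w} T hn⟩

end

theorem mainTheorem8 (k : Type*) [Field k] (V : Type*) [Quiver V] [Fintype V] (l n : ℕ)
    (hn : 2 ≤ n) (hQ : IsBasicCycle V l) :
    (∀ p : ℕ, Module.Finite k (HH k (TruncatedQuiverAlgebra k V n) p)) ∧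
    (hh k (TruncatedQuiverAlgebra k V n) 0 : ℤ) = l + ⌊((n : ℚ) - 1) / l⌋ ∧
    ∀ p : ℕ, 1 ≤ p →
      (¬ (l : ℤ) ∣ ⌊((p : ℚ) + 1) / 2⌋ * n →
        (hh k (TruncatedQuiverAlgebra k V n) p : ℤ) =
          ⌊((⌊(p : ℚ) / 2⌋ : ℚ) * n + n - 1) / l⌋ - ⌊((⌊(p : ℚ) / 2⌋ : ℚ) * n) / l⌋) ∧
      ((l : ℤ) ∣ ⌊((p : ℚ) + 1) / 2⌋ * n → ¬ ringChar k ∣ n / Nat.gcd n l →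
        (hh k (TruncatedQuiverAlgebra k V n) p : ℤ) =
          ⌊((⌊(p : ℚ) / 2⌋ : ℚ) * n + n - 1) / l⌋ - ⌊((⌊(p : ℚ) / 2⌋ : ℚ) * n) / l⌋
            + Nat.gcd n l - 1) ∧
      ((l : ℤ) ∣ ⌊((p : ℚ) + 1) / 2⌋ * n → ringChar k ∣ n / Nat.gcd n l →
        (hh k (TruncatedQuiverAlgebra k V n) p : ℤ) =
          ⌊((⌊(p : ℚ) / 2⌋ : ℚ) * n + n - 1) / l⌋ - ⌊((⌊(p : ℚ) / 2⌋ : ℚ) * n) / l⌋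
            + Nat.gcd n l) := by
  have hn1 : 1 ≤ n := by omega
  have : NeZero l := ⟨by have := hQ.1; omega⟩
  obtain ⟨hfin, h0, hpos⟩ := hQ.hh_truncatedQuiverAlgebra k hn1
  refine ⟨hfin, ?_, fun p hp => ?_⟩
  · have h := Rat.floor_natCast_add_sub_one_div 0 n l hn1
    rw [Nat.cast_zero, zero_add, zero_add] at h
    rw [h0, h, Nat.cast_add]
  have key := hpos p hp
  -- All floors are natural number quotients, so the claim reduces to the additive identity `key`.
  have h1 : ⌊((p : ℚ) + 1) / 2⌋ = ((p + 1) / 2 : ℕ) := by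
    rw [← Rat.floor_natCast_div_two, Nat.cast_add_one]
  have h2 : ⌊((⌊(p : ℚ) / 2⌋ : ℚ) * n) / l⌋ = (p / 2 * n / l : ℕ) := by
    rw [Rat.floor_natCast_div_two, Int.cast_natCast, ← Nat.cast_mul,
      Rat.floor_natCast_div_natCast, Int.natCast_div]
  have h3 : ⌊((⌊(p : ℚ) / 2⌋ : ℚ) * n + n - 1) / l⌋ = ((p / 2 * n + (n - 1)) / l : ℕ) := by
    rw [Rat.floor_natCast_div_two, Int.cast_natCast, ← Nat.cast_mul,
      Rat.floor_natCast_add_sub_one_div _ _ _ hn1]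
  rw [h1, h2, h3, ← Nat.cast_mul, Int.natCast_dvd_natCast]
  refine ⟨fun hd => ?_, fun hd hc => ?_, fun hd hc => ?_⟩
  · rw [if_neg hd] at key
    omega
  · rw [if_pos hd] at key
    have := finrank_normKer_of_not_dvd k l n hc
    omega
  · rw [if_pos hd, finrank_normKer_of_dvd k l n hc] at key
    omega
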